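/- For complex parameters let $(a)_n=a(a+1)\cdots(a+n-1)$ and let $F_3$ be the third Appell function, i.e. the analytic continuation (along segments from the origin) of $$F_3(\alpha,\alpha',\beta,\beta';\gamma;u,v)=\sum_{m,n\ge 0}\frac{(\alpha)_m(\alpha')_n(\beta)_m(\beta')_n}{(\gamma)_{m+n}\,m!\,n!}u^mv^n\qquad(|u|,|v|<1).$$ For $x>0$ and $\operatorname{Re}\gamma>0$ let $$\bigl(I_{0,-}^{\alpha,\alpha',\beta,\beta',\gamma}f\bigr)(x)=\frac{x^{-\alpha'}}{\Gamma(\gamma)}\int_x^\infty (t-x)^{\gamma-1}t^{-\alpha}F_3\Bigl(\alpha,\alpha',\beta,\beta';\gamma;1-\frac xt,1-\frac tx\Bigr)f(t)\,dt .$$ Let $$\mathcal W_{p,b,c}(z)=\sum_{k=0}^\infty\frac{(-1)^kc^k}{\Gamma\bigl(p+\frac{b+1}2+k\bigr)\,k!}\Bigl(\frac z2\Bigr)^{2k+p},\qquad {}_m\psi_n\left[\begin{matrix}(a_i,A_i)_{1,m}\\(b_j,B_j)_{1,n}\end{matrix}\Big|z\right]=\sum_{k=0}^\infty\frac{\prod_{i=1}^m\Gamma(a_i+A_ik)}{\prod_{j=1}^n\Gamma(b_j+B_jk)}\frac{z^k}{k!},$$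 where $1/\Gamma$ is understood to be $0$ at the poles of $\Gamma$ (complex powers are principal). **Theorem.** Let $\alpha,\alpha',\beta,\beta',\gamma,\rho,p,b,c\in\mathbb C$ be such that $\kappa:=p+\frac{b+1}2\notin\{0,-1,-2,\dots\}$, $\operatorname{Re}\gamma>0$ and $$\operatorname{Re}(\rho-p)<1+\min\{\operatorname{Re}(-\beta),\operatorname{Re}(\alpha+\alpha'-\gamma),\operatorname{Re}(\alpha+\beta'-\gamma)\}.$$ Then for every $x>0$ the integral defining the left side below converges absolutely, the series on the right converges, and $$\bigl(I_{0,-}^{\alpha,\alpha',\beta,\beta',\gamma}\,t^{\rho-1}\mathcal W_{p,b,c}(1/t)\bigr)(x)=\frac{x^{\rho-p-\alpha-\alpha'+\gamma-1}}{2^p}\;{}_3\psi_4\left[\begin{matrix}(1-\rho+p-\gamma+\alpha+\alpha',2),\ (1-\rho+p+\alpha+\beta'-\gamma,2),\ (1-\rho+p-\beta,2)\\(1-\rho+p,2),\ (1-\rho+p-\gamma+\alpha+\alpha'+\beta',2),\ (1-\rho+p+\alpha-\beta,2),\ (\kappa,1)\end{matrix}\ \Big|\,-\frac{c}{4x^2}\right].$$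 -/

import Mathlib

open Set Filter Topology MeasureTheory

noncomputable section

/-- The Pochhammer symbol `(a)_n = a (a + 1) ⋯ (a + n - 1)`. -/
def poch (a : ℂ) (n : ℕ) : ℂ := (ascPochhammer ℂ n).eval a

/-- Appell's double series `∑ (α)_m (α')_n (β)_m (β')_n / ((γ)_{m+n} m! n!) u^m v^n`, which
defines the third Appell (Horn) function `F₃` for `|u| < 1`, `|v| < 1`. -/
def appellF3Series (α α' β β' γ : ℂ) (P : ℂ × ℂ) : ℂ :=
  ∑' k : ℕ × ℕ, poch α k.1 * poch α' k.2 * poch β k.1 * poch β' k.2 /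
    (poch γ (k.1 + k.2) * (k.1.factorial : ℂ) * (k.2.factorial : ℂ)) * P.1 ^ k.1 * P.2 ^ k.2

/-- `G` is a holomorphic continuation of Appell's double series to the open set `U`, which is
star-shaped about the origin. -/
structure IsAppellF3Continuation (α α' β β' γ : ℂ) (U : Set (ℂ × ℂ)) (G : ℂ × ℂ → ℂ) : Prop where
  isOpen : IsOpen U
  starConvex : StarConvex ℝ 0 U
  differentiableOn : DifferentiableOn ℂ G U
  eq_series : G =ᶠ[𝓝 0] appellF3Series α α' β β' γ

/-- Two continuations agree wherever both are defined. -/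
theorem IsAppellF3Continuation.unique {α α' β β' γ : ℂ} {U V : Set (ℂ × ℂ)} {G H : ℂ × ℂ → ℂ}
    (hG : IsAppellF3Continuation α α' β β' γ U G) (hH : IsAppellF3Continuation α α' β β' γ V H)
    {P : ℂ × ℂ} (hPU : P ∈ U) (hPV : P ∈ V) : G P = H P := by
  have hL : Differentiable ℂ (fun τ : ℂ => τ • P) := by fun_prop
  have key : ∀ {W : Set (ℂ × ℂ)} {K : ℂ × ℂ → ℂ}, IsAppellF3Continuation α α' β β' γ W K →
      P ∈ W → AnalyticOnNhd ℂ (fun τ : ℂ => K (τ • P)) ((fun t : ℝ => (t : ℂ)) '' Icc 0 1) := by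
    intro W K hK hP
    have hO : IsOpen ((fun τ : ℂ => τ • P) ⁻¹' W) := hK.isOpen.preimage hL.continuous
    have hD : DifferentiableOn ℂ (fun τ : ℂ => K (τ • P)) ((fun τ : ℂ => τ • P) ⁻¹' W) :=
      hK.differentiableOn.comp hL.differentiableOn (fun _ h => h)
    refine (hD.analyticOnNhd hO).mono ?_
    rintro _ ⟨t, ht, rfl⟩
    have := hK.starConvex.smul_mem hP ht.1 ht.2
    simpa using this
  have hpre : IsPreconnected ((fun t : ℝ => (t : ℂ)) '' Icc 0 1) :=
    isPreconnected_Icc.image _ Complex.continuous_ofReal.continuousOn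
  have h0 : (0 : ℂ) ∈ (fun t : ℝ => (t : ℂ)) '' Icc 0 1 := ⟨0, by simp, by simp⟩
  have h1 : (1 : ℂ) ∈ (fun t : ℝ => (t : ℂ)) '' Icc 0 1 := ⟨1, by simp, by simp⟩
  have hev : (fun τ : ℂ => G (τ • P)) =ᶠ[𝓝 0] fun τ : ℂ => H (τ • P) := by
    have ht : Tendsto (fun τ : ℂ => τ • P) (𝓝 0) (𝓝 0) := by
      have := hL.continuous.tendsto 0
      simpa using this
    exact ht.eventually (hG.eq_series.trans hH.eq_series.symm)
  have := (key hG hPU).eqOn_of_preconnected_of_eventuallyEq (key hH hPV) hpre h0 hev h1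
  simpa using this

open Classical in
/-- The third Appell (Horn) function `F₃(α, α', β, β'; γ; u, v)`: the value at `(u, v)` of the
holomorphic continuation of Appell's double series along the segment from the origin to `(u, v)`
(principal branch); `0` if there is none. -/
def appellF3 (α α' β β' γ u v : ℂ) : ℂ :=
  if h : ∃ w : ℂ, ∃ (U : Set (ℂ × ℂ)) (G : ℂ × ℂ → ℂ),
      IsAppellF3Continuation α α' β β' γ U G ∧ (u, v) ∈ U ∧ G (u, v) = w
  then h.choose else 0

/-- Every continuation computes `F₃`. -/
theorem IsAppellF3Continuation.appellF3_eq {α α' β β' γ u v : ℂ} {U : Set (ℂ × ℂ)}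
    {G : ℂ × ℂ → ℂ} (hG : IsAppellF3Continuation α α' β β' γ U G) (hU : (u, v) ∈ U) :
    appellF3 α α' β β' γ u v = G (u, v) := by
  have h : ∃ w : ℂ, ∃ (U : Set (ℂ × ℂ)) (G : ℂ × ℂ → ℂ),
      IsAppellF3Continuation α α' β β' γ U G ∧ (u, v) ∈ U ∧ G (u, v) = w :=
    ⟨_, U, G, hG, hU, rfl⟩
  obtain ⟨V, H, hH, hV, hw⟩ := h.choose_spec
  rw [appellF3, dif_pos h, ← hw]
  exact hH.unique hG hV hU

/-- The integrand of the right-sided Marichev-Saigo-Maeda operator,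
`(t - x)^{γ - 1} t^{-α} F₃(α, α', β, β'; γ; 1 - x/t, 1 - t/x) f(t)`. -/
def msmRightIntegrand (α α' β β' γ : ℂ) (f : ℝ → ℂ) (x t : ℝ) : ℂ :=
  ((t - x : ℝ) : ℂ) ^ (γ - 1) * (t : ℂ) ^ (-α) *
    appellF3 α α' β β' γ (1 - (x : ℂ) / (t : ℂ)) (1 - (t : ℂ) / (x : ℂ)) * f t

/-- The right-sided Marichev-Saigo-Maeda operator `I_{0,-}^{α,α',β,β',γ}`. -/
def msmRight (α α' β β' γ : ℂ) (f : ℝ → ℂ) (x : ℝ) : ℂ :=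
  (x : ℂ) ^ (-α') / Complex.Gamma γ * ∫ t in Ioi x, msmRightIntegrand α α' β β' γ f x t

/-- The generalized Bessel function of the first kind `𝓦_{p,b,c}`. The value `0` that
`Complex.Gamma` takes at its poles makes `1 / Γ` vanish there, as usual. -/
def besselW (p b c z : ℂ) : ℂ :=
  ∑' k : ℕ, (-1) ^ k * c ^ k / (Complex.Gamma (p + (b + 1) / 2 + (k : ℂ)) * (k.factorial : ℂ)) *
    (z / 2) ^ (2 * (k : ℂ) + p)

/-- The `k`-th term of the generalized Wright series `ₚψ_q` with upper parameters `(a i, A i)` and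
lower parameters `(b j, B j)`. A lower parameter at a pole of `Γ` makes the term vanish. -/
def wrightTerm {p q : ℕ} (a : Fin p → ℂ) (A : Fin p → ℝ) (b : Fin q → ℂ) (B : Fin q → ℝ)
    (z : ℂ) (k : ℕ) : ℂ :=
  (∏ i, Complex.Gamma (a i + (A i : ℂ) * (k : ℂ))) /
    (∏ j, Complex.Gamma (b j + (B j : ℂ) * (k : ℂ))) * (z ^ k / (k.factorial : ℂ))

/-- The generalized Wright function `ₚψ_q`. -/
def wrightPsi {p q : ℕ} (a : Fin p → ℂ) (A : Fin p → ℝ) (b : Fin q → ℂ) (B : Fin q → ℝ)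
    (z : ℂ) : ℂ :=
  ∑' k : ℕ, wrightTerm a A b B z k

end

/-!
The integral is evaluated on a power `t ^ (σ - 1)` first; the theorem then follows by integrating
the expansion of `𝓦_{p,b,c}(1 / t)` term by term, since for `t > x` the `k`-th term is dominated by
`x ^ (-2 k)` times the zeroth one and the coefficients decay faster than any geometric sequence.

For a power, Pfaff's transformation (`tsum_pfaff`) applied to the inner sum of Appell's series gives
`F₃(u, v) = (1 - v) ^ (-α') ∑ e_{m,n} u ^ m (v / (v - 1)) ^ n` with coefficients `e_{m,n}`
(`pfaffCoeff`) of polynomial growth. The right side is holomorphic for `|u| < 1`, `Re v < 1 / 2`, a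
convex set, so it is the continuation of `F₃` there (`isAppellF3Continuation_pfaff`). On the curve
`u = 1 - x / t`, `v = 1 - t / x` both arguments `u` and `v / (v - 1)` equal `w = 1 - x / t`. Hence,
in the variable `w ∈ (0, 1)`, the integrand is `w ^ (γ - 1) (1 - w) ^ (A - 1)` times a power series
in `w`, where `A = 1 + α + α' - γ - σ`. Each term is a Beta integral, and the resulting double
series is summed by applying Gauss's theorem (`tsum_gaussTerm`) first in `n` and then in `m`; the
three conditions on `Re σ` are exactly the convergence conditions of the Beta integrals and of the two
Gauss series.

The interchange of sum and integral is absolutely convergent when `Re α' > 0`. In general a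
contiguous relation (`pfaffSeries_contiguous`) expresses the integrand through those with
`(α' + 1, β', γ)` and `(α' + 1, β' + 1, γ + 1)`, for which the conditions on `σ` still hold, so that
`α'` can be raised until its real part is positive (`pfaffIntegrand_integral`). All estimates come
from Euler's limit formula, in the form `|(s)_n| ≍ n! (n + 1) ^ (Re s - 1)`.
-/

/-! ### The Pochhammer symbol -/

@[simp] theorem poch_zero (a : ℂ) : poch a 0 = 1 := by simp [poch]

theorem poch_succ (a : ℂ) (n : ℕ) : poch a (n + 1) = poch a n * (a + n) := by
  simp [poch, ascPochhammer_succ_eval]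

theorem poch_add (a : ℂ) (m n : ℕ) : poch a (m + n) = poch a m * poch (a + m) n := by
  induction n with
  | zero => simp
  | succ n ih => rw [← add_assoc, poch_succ, poch_succ, ih]; push_cast; ring

theorem poch_succ_left (a : ℂ) (n : ℕ) : poch a (n + 1) = a * poch (a + 1) n := by
  rw [add_comm, poch_add, poch_succ]; simp

theorem mul_poch_add_one (a : ℂ) (n : ℕ) : a * poch (a + 1) n = (a + n) * poch a n := by
  rw [← poch_succ_left, poch_succ, mul_comm]

theorem poch_ne_zero {a : ℂ} (ha : ∀ k : ℕ, a ≠ -k) (n : ℕ) : poch a n ≠ 0 := by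
  induction n with
  | zero => simp
  | succ n ih =>
    rw [poch_succ]
    exact mul_ne_zero ih fun h => ha n (eq_neg_of_add_eq_zero_left h)

theorem ne_neg_natCast_of_re_pos {a : ℂ} (ha : 0 < a.re) (k : ℕ) : a ≠ -k := by
  rintro rfl
  simp at ha
  exact absurd ha (not_lt.2 k.cast_nonneg)

theorem poch_ne_zero_of_re_pos {a : ℂ} (ha : 0 < a.re) (n : ℕ) : poch a n ≠ 0 :=
  poch_ne_zero (ne_neg_natCast_of_re_pos ha) n

/-- Valid at the poles of `Γ` as well, thanks to the convention `1 / 0 = 0`. -/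
theorem inv_Gamma_eq_poch_mul (a : ℂ) (n : ℕ) :
    (Complex.Gamma a)⁻¹ = poch a n * (Complex.Gamma (a + n))⁻¹ := by
  induction n with
  | zero => simp
  | succ n ih =>
    rw [ih, Complex.one_div_Gamma_eq_self_mul_one_div_Gamma_add_one, poch_succ]
    push_cast
    rw [← add_assoc]; ring

theorem Gamma_add_natCast {a : ℂ} (ha : ∀ k : ℕ, a ≠ -k) (n : ℕ) :
    Complex.Gamma (a + n) = poch a n * Complex.Gamma a := by
  have h := inv_Gamma_eq_poch_mul a n
  have h1 := Complex.Gamma_ne_zero ha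
  have h2 : Complex.Gamma (a + n) ≠ 0 := by
    intro h0
    rw [h0] at h
    simp at h
    exact h1 h
  field_simp at h
  rw [h]; ring

theorem poch_eq_prod (a : ℂ) (n : ℕ) : poch a n = ∏ j ∈ Finset.range n, (a + j) := by
  induction n with
  | zero => simp
  | succ n ih => rw [poch_succ, ih, Finset.prod_range_succ]

/-- Euler's limit formula for `1 / Γ`. -/
theorem tendsto_poch_div (s : ℂ) :
    Tendsto (fun n : ℕ => poch s (n + 1) / ((n : ℂ) ^ s * (n.factorial : ℂ))) atTop
      (𝓝 (Complex.Gamma s)⁻¹) := by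
  by_cases hs : ∀ k : ℕ, s ≠ -k
  · have := (Complex.GammaSeq_tendsto_Gamma s).inv₀ (Complex.Gamma_ne_zero hs)
    refine this.congr fun n => ?_
    rw [Complex.GammaSeq, inv_div, poch_eq_prod]
  · push Not at hs
    obtain ⟨k, rfl⟩ := hs
    rw [Complex.Gamma_neg_nat_eq_zero, inv_zero]
    refine tendsto_const_nhds.congr' ?_
    filter_upwards [eventually_ge_atTop k] with n hn
    rw [show n + 1 = k + 1 + (n - k) by omega, poch_add, poch_succ]
    simp

theorem tendsto_norm_poch_div (s : ℂ) :
    Tendsto (fun n : ℕ => ‖poch s n‖ / (n.factorial * (n + 1 : ℝ) ^ (s.re - 1))) atTop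
      (𝓝 ‖(Complex.Gamma s)⁻¹‖) := by
  rw [← tendsto_add_atTop_iff_nat 1]
  have h1 : Tendsto (fun n : ℕ => ((n : ℝ) / ((n : ℝ) + 1))) atTop (𝓝 1) :=
    tendsto_natCast_div_add_atTop 1
  have h2 : Tendsto (fun n : ℕ => ((n : ℝ) / ((n : ℝ) + 2)) ^ (s.re - 1)) atTop (𝓝 1) := by
    have := (tendsto_natCast_div_add_atTop (2 : ℝ)).rpow_const (p := s.re - 1) (Or.inl one_ne_zero)
    simpa using this
  have h3 := ((tendsto_poch_div s).norm.mul h1).mul h2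
  simp only [mul_one] at h3
  refine h3.congr' ?_
  filter_upwards [eventually_gt_atTop 0] with n hn
  have hn' : (0 : ℝ) < n := by exact_mod_cast hn
  rw [norm_div, norm_mul, Complex.norm_natCast, Complex.norm_natCast_cpow_of_pos hn,
    Real.div_rpow hn'.le (by positivity), Real.rpow_sub_one hn'.ne', Nat.factorial_succ]
  push_cast
  rw [show (n : ℝ) + 1 + 1 = n + 2 by ring]
  have : (n : ℝ) ^ s.re ≠ 0 := (Real.rpow_pos_of_pos hn' _).ne'
  have : (n + 2 : ℝ) ^ (s.re - 1) ≠ 0 := (Real.rpow_pos_of_pos (by positivity) _).ne'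
  field_simp

theorem exists_norm_poch_le (s : ℂ) : ∃ C : ℝ, 0 < C ∧ ∀ n : ℕ,
    ‖poch s n‖ ≤ C * (n.factorial * (n + 1 : ℝ) ^ (s.re - 1)) := by
  obtain ⟨C, hC⟩ := (tendsto_norm_poch_div s).bddAbove_range
  refine ⟨max C 1, by positivity, fun n => ?_⟩
  have := hC ⟨n, rfl⟩
  have hp : (0 : ℝ) < n.factorial * (n + 1 : ℝ) ^ (s.re - 1) := by positivity
  rw [← div_le_iff₀ hp]
  exact this.trans (le_max_left _ _)

theorem exists_le_norm_poch {s : ℂ} (hs : ∀ k : ℕ, s ≠ -k) : ∃ C : ℝ, 0 < C ∧ ∀ n : ℕ,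
    n.factorial * (n + 1 : ℝ) ^ (s.re - 1) ≤ C * ‖poch s n‖ := by
  have h := (tendsto_norm_poch_div s).inv₀
    (norm_ne_zero_iff.2 (inv_ne_zero (Complex.Gamma_ne_zero hs)))
  obtain ⟨C, hC⟩ := h.bddAbove_range
  refine ⟨max C 1, by positivity, fun n => ?_⟩
  have := hC ⟨n, rfl⟩
  simp only [inv_div] at this
  rw [← div_le_iff₀ (norm_pos_iff.2 (poch_ne_zero hs n))]
  exact this.trans (le_max_left _ _)

theorem norm_poch_le_norm_poch {a b : ℂ} (h : ∀ j : ℕ, ‖a + j‖ ≤ ‖b + j‖) (n : ℕ) :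
    ‖poch a n‖ ≤ ‖poch b n‖ := by
  rw [poch_eq_prod, poch_eq_prod, norm_prod, norm_prod]
  exact Finset.prod_le_prod (fun _ _ => norm_nonneg _) fun j _ => h j

/-- The constant is uniform in the shift `m`. -/
theorem exists_norm_poch_shift_le (s : ℂ) : ∃ C : ℝ, 0 < C ∧ ∀ m n : ℕ,
    ‖poch (s + m) n‖ ≤ C * ((m + n).factorial * (m + n + 1 : ℝ) ^ (s.re - 1) /
      (m.factorial * (m + 1 : ℝ) ^ (s.re - 1))) := by
  -- Moving `s` off the real axis, away from the zeros of the Pochhammer symbol, only increases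
  -- the norm.
  set z : ℂ := ⟨s.re, |s.im| + 1⟩ with hz
  have hle : ∀ m n : ℕ, ‖poch (s + m) n‖ ≤ ‖poch (z + m) n‖ := by
    refine fun m n => norm_poch_le_norm_poch (fun j => ?_) n
    rw [Complex.norm_def, Complex.norm_def]
    refine Real.sqrt_le_sqrt ?_
    simp only [Complex.normSq_apply, Complex.add_re, Complex.add_im, Complex.natCast_re,
      Complex.natCast_im, hz, add_zero]
    nlinarith [sq_abs s.im, abs_nonneg s.im]
  have hz0 : ∀ k : ℕ, z ≠ -k := by
    intro k h
    have := congrArg Complex.im h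
    simp only [hz, Complex.neg_im, Complex.natCast_im, neg_zero] at this
    linarith [abs_nonneg s.im]
  obtain ⟨C₁, h1, hC₁⟩ := exists_norm_poch_le z
  obtain ⟨C₂, h2, hC₂⟩ := exists_le_norm_poch hz0
  refine ⟨C₁ * C₂, by positivity, fun m n => (hle m n).trans ?_⟩
  have hp := norm_pos_iff.2 (poch_ne_zero hz0 m)
  have hq : (0 : ℝ) < m.factorial * (m + 1 : ℝ) ^ (s.re - 1) := by positivity
  have e : ‖poch (z + m) n‖ = ‖poch z (m + n)‖ / ‖poch z m‖ := by
    rw [poch_add, norm_mul]; field_simp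
  rw [e, ← mul_div_assoc, div_le_div_iff₀ hp hq]
  have a1 := hC₁ (m + n)
  have a2 := hC₂ m
  push_cast at a1
  calc ‖poch z (m + n)‖ * (m.factorial * (m + 1 : ℝ) ^ (s.re - 1))
      ≤ (C₁ * ((m + n).factorial * (m + n + 1 : ℝ) ^ (s.re - 1))) * (C₂ * ‖poch z m‖) := by
        gcongr
    _ = _ := by ring

/-- Holds at the poles of `Γ` as well, by descent from `c + 1` to `c`. -/
theorem exists_norm_inv_Gamma_le (c : ℂ) : ∃ C : ℝ, 0 < C ∧ ∀ n : ℕ,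
    ‖(Complex.Gamma (c + n))⁻¹‖ ≤ C / (n.factorial * (n + 1 : ℝ) ^ (c.re - 1)) := by
  obtain ⟨k, hk⟩ := exists_nat_gt (-c.re)
  induction k generalizing c with
  | zero =>
    have hc : 0 < c.re := by simpa using hk
    obtain ⟨C, h0, hC⟩ := exists_le_norm_poch (ne_neg_natCast_of_re_pos hc)
    have hG := Complex.Gamma_ne_zero_of_re_pos hc
    refine ⟨C * ‖(Complex.Gamma c)⁻¹‖, mul_pos h0 (norm_pos_iff.2 (inv_ne_zero hG)), fun n => ?_⟩
    have hp := norm_pos_iff.2 (poch_ne_zero_of_re_pos hc n)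
    rw [le_div_iff₀ (by positivity), inv_Gamma_eq_poch_mul c n, norm_mul]
    calc _ ≤ ‖(Complex.Gamma (c + n))⁻¹‖ * (C * ‖poch c n‖) :=
          mul_le_mul_of_nonneg_left (hC n) (norm_nonneg _)
      _ = _ := by ring
  | succ k ih =>
    obtain ⟨C, h0, hC⟩ := ih (c + 1) (by push_cast at hk; simp; linarith)
    refine ⟨C * (‖c‖ + 1), by positivity, fun n => ?_⟩
    have h1 : ‖c + n‖ ≤ (‖c‖ + 1) * (n + 1) := by
      refine (norm_add_le _ _).trans ?_
      rw [Complex.norm_natCast]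
      nlinarith [norm_nonneg c, n.cast_nonneg (α := ℝ),
        mul_nonneg (norm_nonneg c) (n.cast_nonneg (α := ℝ))]
    have h2 := hC n
    rw [add_right_comm] at h2
    rw [Complex.one_div_Gamma_eq_self_mul_one_div_Gamma_add_one, norm_mul]
    have hn : (0 : ℝ) < n + 1 := by positivity
    rw [Complex.add_re, Complex.one_re, add_sub_cancel_right] at h2
    calc _ ≤ ((‖c‖ + 1) * (n + 1)) * (C / (n.factorial * (n + 1 : ℝ) ^ c.re)) := by gcongr
      _ = _ := by
        rw [Real.rpow_sub_one hn.ne']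
        field_simp

theorem summable_add_one_rpow {e : ℝ} (he : e < -1) : Summable fun n : ℕ => (n + 1 : ℝ) ^ e := by
  have := (summable_nat_add_iff 1).2 (Real.summable_nat_rpow.2 he)
  simpa using this

/-! ### Gauss's summation theorem -/

/-- The term of Gauss's series `∑ (a)_n (b)_n / (n! Γ(c + n))`, regularized so that `c` may be a
pole of `Γ`. -/
noncomputable def gaussTerm (a b c : ℂ) (n : ℕ) : ℂ :=
  poch a n * poch b n / (n.factorial : ℂ) * (Complex.Gamma (c + n))⁻¹

theorem exists_norm_gaussTerm_le (a b c : ℂ) : ∃ C : ℝ, 0 < C ∧ ∀ n : ℕ,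
    ‖gaussTerm a b c n‖ ≤ C * (n + 1 : ℝ) ^ (a.re + b.re - c.re - 1) := by
  obtain ⟨C₁, h1, hC₁⟩ := exists_norm_poch_le a
  obtain ⟨C₂, h2, hC₂⟩ := exists_norm_poch_le b
  obtain ⟨C₃, h3, hC₃⟩ := exists_norm_inv_Gamma_le c
  refine ⟨C₁ * C₂ * C₃, by positivity, fun n => ?_⟩
  have hn : (0 : ℝ) < n + 1 := by positivity
  rw [gaussTerm, norm_mul, norm_div, norm_mul, Complex.norm_natCast]
  calc _ ≤ (C₁ * (n.factorial * (n + 1 : ℝ) ^ (a.re - 1))) *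
        (C₂ * (n.factorial * (n + 1 : ℝ) ^ (b.re - 1))) / n.factorial *
        (C₃ / (n.factorial * (n + 1 : ℝ) ^ (c.re - 1))) := by
        gcongr
        exacts [hC₁ n, hC₂ n, hC₃ n]
    _ = _ := by
      rw [show a.re + b.re - c.re - 1 = (a.re - 1) + (b.re - 1) - (c.re - 1) by ring,
        Real.rpow_sub hn _ (c.re - 1), Real.rpow_add hn]
      have : (n.factorial : ℝ) ≠ 0 := by positivity
      field_simp

theorem summable_gaussTerm {a b c : ℂ} (h : 0 < (c - a - b).re) : Summable (gaussTerm a b c) := by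
  obtain ⟨C, -, hC⟩ := exists_norm_gaussTerm_le a b c
  simp only [Complex.sub_re] at h
  exact .of_norm_bounded ((summable_add_one_rpow (by linarith)).mul_left C) hC

theorem tendsto_natCast_mul_gaussTerm {a b c : ℂ} (h : 0 < (c - a - b).re) :
    Tendsto (fun n : ℕ => n * gaussTerm a b c n) atTop (𝓝 0) := by
  obtain ⟨C, h0, hC⟩ := exists_norm_gaussTerm_le a b c
  simp only [Complex.sub_re] at h
  have h1 : Tendsto (fun n : ℕ => C * (n + 1 : ℝ) ^ (-(c.re - a.re - b.re))) atTop (𝓝 0) := by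
    have := ((tendsto_rpow_neg_atTop h).comp
      (tendsto_natCast_atTop_atTop.atTop_add tendsto_const_nhds (C := (1 : ℝ)))).const_mul C
    simpa using this
  refine squeeze_zero_norm (fun n => ?_) h1
  have hn : (0 : ℝ) < n + 1 := by positivity
  rw [norm_mul, Complex.norm_natCast]
  calc _ ≤ (n + 1 : ℝ) * (C * (n + 1 : ℝ) ^ (a.re + b.re - c.re - 1)) := by
        gcongr
        exacts [by linarith, hC n]
    _ = _ := by
      rw [Real.rpow_sub_one hn.ne', show -(c.re - a.re - b.re) = a.re + b.re - c.re by ring]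
      field_simp

/-- The contiguous relation for Gauss's series at `1`, by telescoping. -/
theorem tsum_gaussTerm_contiguous {a b c : ℂ} (h : 0 < (c - a - b).re) :
    (c - a - b) * ∑' n, gaussTerm a b c n =
      (c - a) * (c - b) * ∑' n, gaussTerm a b (c + 1) n := by
  have h' : 0 < (c + 1 - a - b).re := by simp at h ⊢; linarith
  have s1 := (summable_gaussTerm h).hasSum.mul_left (c - a - b)
  have s2 := (summable_gaussTerm h').hasSum.mul_left ((c - a) * (c - b))
  have key : ∀ n : ℕ, (c - a - b) * gaussTerm a b c n -
      (c - a) * (c - b) * gaussTerm a b (c + 1) n =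
      n * gaussTerm a b c n - (n + 1 : ℕ) * gaussTerm a b c (n + 1) := by
    intro n
    have e : c + 1 + n = c + n + 1 := by ring
    have : (n.factorial : ℂ) ≠ 0 := by exact_mod_cast n.factorial_ne_zero
    have : (n + 1 : ℂ) ≠ 0 := by exact_mod_cast n.succ_ne_zero
    simp only [gaussTerm, poch_succ, Nat.factorial_succ]
    rw [Complex.one_div_Gamma_eq_self_mul_one_div_Gamma_add_one (c + n), e]
    push_cast
    rw [← add_assoc]
    field_simp
    ring
  have s3 := s1.sub s2
  simp only [key] at s3
  have s4 := s3.tendsto_sum_nat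
  simp only [Finset.sum_range_sub' (fun n : ℕ => (n : ℂ) * gaussTerm a b c n)] at s4
  have s5 : Tendsto (fun n : ℕ => ((0 : ℕ) : ℂ) * gaussTerm a b c 0 - n * gaussTerm a b c n) atTop
      (𝓝 0) := by
    simpa using (tendsto_natCast_mul_gaussTerm h).neg
  exact sub_eq_zero.1 (tendsto_nhds_unique s4 s5)

theorem tsum_gaussTerm_eq_poch_mul {a b c : ℂ} (h : 0 < (c - a - b).re) (M : ℕ) :
    ∑' n, gaussTerm a b c n =
      poch (c - a) M * poch (c - b) M / poch (c - a - b) M * ∑' n, gaussTerm a b (c + M) n := by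
  induction M with
  | zero => simp
  | succ M ih =>
    have hM : 0 < (c + M - a - b).re := by
      simp only [Complex.sub_re, Complex.add_re, Complex.natCast_re] at h ⊢
      linarith [M.cast_nonneg (α := ℝ)]
    have h1 := tsum_gaussTerm_contiguous hM
    have h2 : c - a - b + M ≠ 0 := by
      intro h0
      rw [show c + M - a - b = c - a - b + M by ring, h0] at hM
      simp at hM
    have h3 := poch_ne_zero_of_re_pos h M
    rw [ih, poch_succ, poch_succ, poch_succ]
    push_cast
    rw [← add_assoc]
    rw [show c + M - a - b = c - a - b + M by ring, show c + M - a = c - a + M by ring,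
      show c + M - b = c - b + M by ring] at h1
    field_simp
    linear_combination poch (c - a) M * poch (c - b) M * h1

theorem tendsto_inv_poch_add_natCast (c : ℂ) (n : ℕ) :
    Tendsto (fun M : ℕ => (poch (c + M) n)⁻¹) atTop (𝓝 (if n = 0 then 1 else 0)) := by
  induction n with
  | zero => simp
  | succ n ih =>
    simp only [poch_succ, mul_inv]
    have : Tendsto (fun M : ℕ => (c + M + n)⁻¹) atTop (𝓝 0) := by
      refine tendsto_inv₀_cobounded.comp ?_
      rw [← tendsto_norm_atTop_iff_cobounded]
      refine tendsto_atTop_mono (f := fun M : ℕ => (M : ℝ) - ‖c + n‖) (fun M => ?_)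
        (tendsto_atTop_add_const_right _ _ tendsto_natCast_atTop_atTop)
      have := norm_sub_norm_le (M : ℂ) (-(c + n))
      rwa [norm_neg, Complex.norm_natCast, sub_neg_eq_add,
        show (M : ℂ) + (c + n) = c + M + n by ring] at this
    simpa using ih.mul this

/-- Gauss's theorem for `Re c > 0`, where raising `c` makes the contiguous relation converge to
Euler's limit formula. -/
theorem tsum_gaussTerm_of_re_pos {a b c : ℂ} (hc : 0 < c.re) (h : 0 < (c - a - b).re) :
    ∑' n, gaussTerm a b c n =
      Complex.Gamma (c - a - b) * (Complex.Gamma (c - a))⁻¹ * (Complex.Gamma (c - b))⁻¹ := by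
  have hG := Complex.Gamma_ne_zero_of_re_pos hc
  have hG' := Complex.Gamma_ne_zero_of_re_pos h
  have hc' : 0 < ((c.re : ℂ)).re := by simpa
  -- Tannery's theorem: as the shift grows only the constant term survives.
  have t1 : Tendsto (fun M : ℕ => ∑' n : ℕ, poch a n * poch b n / (n.factorial : ℂ) *
      (poch (c + M) n)⁻¹) atTop
      (𝓝 (∑' n : ℕ, poch a n * poch b n / (n.factorial : ℂ) * (if n = 0 then 1 else 0))) := by
    have hs : Summable fun n : ℕ => ‖Complex.Gamma (c.re : ℂ)‖ * ‖gaussTerm a b (c.re : ℂ) n‖ :=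
      (summable_gaussTerm (by simpa using h)).norm.mul_left _
    refine tendsto_tsum_of_dominated_convergence hs
      (fun n => (tendsto_inv_poch_add_natCast c n).const_mul _) (Eventually.of_forall fun M n => ?_)
    have hle : ‖poch (c.re : ℂ) n‖ ≤ ‖poch (c + M) n‖ := by
      refine norm_poch_le_norm_poch (fun j => ?_) n
      rw [← Complex.ofReal_natCast, ← Complex.ofReal_add, Complex.norm_real,
        Real.norm_of_nonneg (by positivity)]
      refine le_trans ?_ (Complex.re_le_norm _)
      simp
    have hp := poch_ne_zero_of_re_pos hc' n
    have hg := Complex.Gamma_ne_zero_of_re_pos hc'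
    rw [gaussTerm, Gamma_add_natCast (ne_neg_natCast_of_re_pos hc'), ← norm_mul, mul_inv,
      show Complex.Gamma (c.re : ℂ) * (poch a n * poch b n / (n.factorial : ℂ) *
        ((poch (c.re : ℂ) n)⁻¹ * (Complex.Gamma (c.re : ℂ))⁻¹)) =
        poch a n * poch b n / (n.factorial : ℂ) * (poch (c.re : ℂ) n)⁻¹ by field_simp,
      norm_mul, norm_mul, norm_inv, norm_inv]
    have := norm_pos_iff.2 hp
    gcongr
  have e1 : (∑' n : ℕ, poch a n * poch b n / (n.factorial : ℂ) * (if n = 0 then 1 else 0)) = 1 := by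
    rw [tsum_eq_single 0 (fun n hn => by simp [hn])]
    simp
  rw [e1, ← tendsto_add_atTop_iff_nat 1] at t1
  have t2 := ((((tendsto_poch_div (c - a)).mul (tendsto_poch_div (c - b))).div
    (tendsto_poch_div (c - a - b)) (inv_ne_zero hG')).div (tendsto_poch_div c)
    (inv_ne_zero hG)).mul (t1.mul_const (Complex.Gamma c)⁻¹)
  have t3 : Tendsto (fun _ : ℕ => ∑' n, gaussTerm a b c n) atTop 
      (𝓝 ((Complex.Gamma (c - a))⁻¹ * (Complex.Gamma (c - b))⁻¹ / (Complex.Gamma (c - a - b))⁻¹ /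
        (Complex.Gamma c)⁻¹ * (1 * (Complex.Gamma c)⁻¹))) := by
    refine t2.congr' ?_
    filter_upwards [eventually_gt_atTop 0] with M hM
    simp only [Pi.div_apply]
    have hM' : (M : ℂ) ≠ 0 := by exact_mod_cast hM.ne'
    have hf : (M.factorial : ℂ) ≠ 0 := by exact_mod_cast M.factorial_ne_zero
    rw [tsum_gaussTerm_eq_poch_mul h (M + 1)]
    have e2 : ∑' n, gaussTerm a b (c + (M + 1 : ℕ)) n =
        (poch c (M + 1) * Complex.Gamma c)⁻¹ * ∑' n : ℕ, poch a n * poch b n / (n.factorial : ℂ) *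
          (poch (c + (M + 1 : ℕ)) n)⁻¹ := by
      rw [← tsum_mul_left]
      congr 1 with n
      rw [gaussTerm, Gamma_add_natCast, Gamma_add_natCast (ne_neg_natCast_of_re_pos hc),
        mul_inv]
      · ring
      · refine ne_neg_natCast_of_re_pos ?_
        simp only [Complex.add_re, Complex.natCast_re]
        positivity
    have hpow : (M : ℂ) ^ (c - a) * (M : ℂ) ^ (c - b) =
        (M : ℂ) ^ (c - a - b) * (M : ℂ) ^ c := by
      rw [← Complex.cpow_add _ _ hM', ← Complex.cpow_add _ _ hM']
      congr 1; ring
    have n1 : (M : ℂ) ^ (c - a) ≠ 0 := by simp [Complex.cpow_eq_zero_iff, hM']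
    have n2 : (M : ℂ) ^ (c - b) ≠ 0 := by simp [Complex.cpow_eq_zero_iff, hM']
    have n3 : (M : ℂ) ^ (c - a - b) ≠ 0 := by simp [Complex.cpow_eq_zero_iff, hM']
    have n4 : (M : ℂ) ^ c ≠ 0 := by simp [Complex.cpow_eq_zero_iff, hM']
    have n5 := poch_ne_zero_of_re_pos h (M + 1)
    have n6 := poch_ne_zero_of_re_pos hc (M + 1)
    rw [e2]
    set S := ∑' n : ℕ, poch a n * poch b n / (n.factorial : ℂ) * (poch (c + (M + 1 : ℕ)) n)⁻¹
    field_simp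
    linear_combination (-poch (c - a) (M + 1) * poch (c - b) (M + 1) * S) * hpow
  rw [tendsto_nhds_unique tendsto_const_nhds t3]
  field_simp

/-- **Gauss's summation theorem**, in a form without restriction on `c`. -/
theorem tsum_gaussTerm {a b c : ℂ} (h : 0 < (c - a - b).re) :
    ∑' n, gaussTerm a b c n =
      Complex.Gamma (c - a - b) * (Complex.Gamma (c - a))⁻¹ * (Complex.Gamma (c - b))⁻¹ := by
  obtain ⟨k, hk⟩ := exists_nat_gt (-c.re)
  have hc : 0 < (c + k).re := by simp; linarith
  have hck : 0 < (c + k - a - b).re := by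
    simp only [Complex.sub_re, Complex.add_re, Complex.natCast_re] at h ⊢
    linarith [k.cast_nonneg (α := ℝ)]
  rw [tsum_gaussTerm_eq_poch_mul h k, tsum_gaussTerm_of_re_pos hc hck,
    inv_Gamma_eq_poch_mul (c - a) k, inv_Gamma_eq_poch_mul (c - b) k,
    show c + k - a - b = c - a - b + k by ring, Gamma_add_natCast (ne_neg_natCast_of_re_pos h),
    show c + k - a = c - a + k by ring, show c + k - b = c - b + k by ring]
  have := poch_ne_zero_of_re_pos h k
  field_simp

/-! ### Double power series with coefficients of polynomial growth -/

/-- The sequence grows at most polynomially. -/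
def PolyGrowth (f : ℕ → ℂ) : Prop :=
  ∃ C : ℝ, ∃ K : ℕ, ∀ n, ‖f n‖ ≤ C * (n + 1 : ℝ) ^ K

/-- The double sequence grows at most polynomially in both indices. -/
def PolyGrowth₂ (f : ℕ → ℕ → ℂ) : Prop :=
  ∃ C : ℝ, ∃ K : ℕ, ∀ m n, ‖f m n‖ ≤ C * ((m + 1 : ℝ) * (n + 1)) ^ K

theorem PolyGrowth.of_rpow {f : ℕ → ℂ} {C e : ℝ} (hC : 0 < C)
    (h : ∀ n, ‖f n‖ ≤ C * (n + 1 : ℝ) ^ e) : PolyGrowth f := by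
  obtain ⟨K, hK⟩ := exists_nat_ge e
  refine ⟨C, K, fun n => (h n).trans ?_⟩
  rw [← Real.rpow_natCast]
  gcongr
  simp

theorem PolyGrowth.poch_div (s : ℂ) : PolyGrowth fun n => poch s n / (n.factorial : ℂ) := by
  obtain ⟨C, h0, hC⟩ := exists_norm_poch_le s
  refine .of_rpow h0 (e := s.re - 1) fun n => ?_
  rw [norm_div, Complex.norm_natCast, div_le_iff₀ (by positivity)]
  linarith [hC n]

theorem PolyGrowth.div_poch {s : ℂ} (hs : ∀ k : ℕ, s ≠ -k) :
    PolyGrowth fun n => (n.factorial : ℂ) / poch s n := by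
  obtain ⟨C, h0, hC⟩ := exists_le_norm_poch hs
  refine .of_rpow h0 (e := -(s.re - 1)) fun n => ?_
  have hn : (0 : ℝ) < (n + 1 : ℝ) ^ (s.re - 1) := by positivity
  rw [norm_div, Complex.norm_natCast, div_le_iff₀ (norm_pos_iff.2 (poch_ne_zero hs n)),
    Real.rpow_neg (by positivity)]
  have := hC n
  rw [← le_div_iff₀ hn] at this
  refine this.trans_eq ?_
  field_simp

theorem PolyGrowth.nonneg {f : ℕ → ℂ} {C : ℝ} {K : ℕ} (h : ∀ n, ‖f n‖ ≤ C * (n + 1 : ℝ) ^ K) :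
    0 ≤ C := by
  have := (norm_nonneg _).trans (h 0)
  simpa using this

theorem PolyGrowth₂.mul {f g : ℕ → ℕ → ℂ} (hf : PolyGrowth₂ f) (hg : PolyGrowth₂ g) :
    PolyGrowth₂ fun m n => f m n * g m n := by
  obtain ⟨C, K, hC⟩ := hf
  obtain ⟨D, L, hD⟩ := hg
  refine ⟨C * D, K + L, fun m n => ?_⟩
  rw [norm_mul, pow_add]
  calc _ ≤ (C * ((m + 1 : ℝ) * (n + 1)) ^ K) * (D * ((m + 1 : ℝ) * (n + 1)) ^ L) :=
        mul_le_mul (hC m n) (hD m n) (norm_nonneg _) ((norm_nonneg _).trans (hC m n))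
    _ = _ := by ring

theorem PolyGrowth.comp_le {f : ℕ → ℂ} (hf : PolyGrowth f) {i : ℕ → ℕ → ℕ}
    (hi : ∀ m n, (i m n + 1 : ℝ) ≤ (m + 1) * (n + 1)) : PolyGrowth₂ fun m n => f (i m n) := by
  obtain ⟨C, K, hC⟩ := hf
  have h0 := PolyGrowth.nonneg hC
  refine ⟨C, K, fun m n => (hC _).trans ?_⟩
  gcongr
  exact hi m n

theorem PolyGrowth.fst {f : ℕ → ℂ} (hf : PolyGrowth f) : PolyGrowth₂ fun m _ => f m :=
  hf.comp_le fun m n => by nlinarith [m.cast_nonneg (α := ℝ), n.cast_nonneg (α := ℝ)]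

theorem PolyGrowth.snd {f : ℕ → ℂ} (hf : PolyGrowth f) : PolyGrowth₂ fun _ n => f n :=
  hf.comp_le fun m n => by nlinarith [m.cast_nonneg (α := ℝ), n.cast_nonneg (α := ℝ)]

theorem PolyGrowth.add {f : ℕ → ℂ} (hf : PolyGrowth f) : PolyGrowth₂ fun m n => f (m + n) :=
  hf.comp_le fun m n => by
    push_cast
    nlinarith [mul_nonneg (m.cast_nonneg (α := ℝ)) (n.cast_nonneg (α := ℝ))]

theorem PolyGrowth₂.of_norm_le_one {f : ℕ → ℕ → ℂ} (hf : ∀ m n, ‖f m n‖ ≤ 1) : PolyGrowth₂ f :=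
  ⟨1, 0, fun m n => by simpa using hf m n⟩

theorem PolyGrowth₂.poch_shift (s : ℂ) : PolyGrowth₂ fun m n =>
    poch (s + m) n * (m.factorial : ℂ) / ((m + n).factorial : ℂ) := by
  obtain ⟨C, h0, hC⟩ := exists_norm_poch_shift_le s
  obtain ⟨K, hK⟩ := exists_nat_ge |s.re - 1|
  refine ⟨C, 2 * K, fun m n => ?_⟩
  rw [norm_div, norm_mul, Complex.norm_natCast, Complex.norm_natCast,
    div_le_iff₀ (by positivity)]
  have h1 : (m + n + 1 : ℝ) ^ (s.re - 1) ≤ ((m + 1 : ℝ) * (n + 1)) ^ K := by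
    calc _ ≤ (m + n + 1 : ℝ) ^ (K : ℝ) := by
          gcongr
          · linarith [m.cast_nonneg (α := ℝ), n.cast_nonneg (α := ℝ)]
          · exact (le_abs_self _).trans hK
      _ ≤ _ := by
          rw [Real.rpow_natCast]
          gcongr
          nlinarith [mul_nonneg (m.cast_nonneg (α := ℝ)) (n.cast_nonneg (α := ℝ))]
  have h2 : ((m + 1 : ℝ) ^ (s.re - 1))⁻¹ ≤ ((m + 1 : ℝ) * (n + 1)) ^ K := by
    rw [← Real.rpow_neg (by positivity)]
    calc _ ≤ (m + 1 : ℝ) ^ (K : ℝ) := by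
          gcongr
          · linarith [m.cast_nonneg (α := ℝ)]
          · exact (neg_le_abs _).trans hK
      _ ≤ _ := by
          rw [Real.rpow_natCast]
          gcongr
          nlinarith [m.cast_nonneg (α := ℝ), n.cast_nonneg (α := ℝ)]
  have hm : (0 : ℝ) < m.factorial := by positivity
  calc _ ≤ C * ((m + n).factorial * (m + n + 1 : ℝ) ^ (s.re - 1) /
      (m.factorial * (m + 1 : ℝ) ^ (s.re - 1))) * m.factorial := by gcongr; exact hC m n
    _ = C * (m + n).factorial * ((m + n + 1 : ℝ) ^ (s.re - 1) * ((m + 1 : ℝ) ^ (s.re - 1))⁻¹) := by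
        field_simp
    _ ≤ C * (m + n).factorial * (((m + 1 : ℝ) * (n + 1)) ^ K * ((m + 1 : ℝ) * (n + 1)) ^ K) := by
        gcongr
    _ = _ := by rw [two_mul, pow_add]; ring

theorem summable_add_one_pow_mul_geometric {r : ℝ} (h0 : 0 ≤ r) (h1 : r < 1) (K : ℕ) :
    Summable fun n : ℕ => (n + 1 : ℝ) ^ K * r ^ n := by
  obtain ⟨q, hq, hq1⟩ := exists_between h1
  have hq0 : 0 < q := h0.trans_lt hq
  have hs : Summable fun n : ℕ => (n : ℝ) ^ K * q ^ n :=
    summable_pow_mul_geometric_of_norm_lt_one K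
      (show ‖q‖ < 1 by rwa [Real.norm_of_nonneg hq0.le])
  have hs' := ((summable_nat_add_iff 1).2 hs).mul_right q⁻¹
  refine .of_nonneg_of_le (fun n => by positivity) (fun n => ?_) hs'
  rw [pow_succ, ← mul_assoc, mul_assoc, mul_inv_cancel₀ hq0.ne', mul_one]
  push_cast
  gcongr

theorem summable_poly_mul_geometric₂ {r s : ℝ} (h0 : 0 ≤ r) (h1 : r < 1) (h2 : 0 ≤ s) (h3 : s < 1)
    (C : ℝ) (K : ℕ) :
    Summable fun k : ℕ × ℕ => C * ((k.1 + 1 : ℝ) * (k.2 + 1)) ^ K * (r ^ k.1 * s ^ k.2) := by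
  have := ((summable_add_one_pow_mul_geometric h0 h1 K).mul_of_nonneg
    (summable_add_one_pow_mul_geometric h2 h3 K) (fun n => by positivity)
    (fun n => by positivity)).mul_left C
  refine this.congr fun k => ?_
  rw [mul_pow]; ring

theorem PolyGrowth₂.summable {f : ℕ → ℕ → ℂ} (hf : PolyGrowth₂ f) {u v : ℂ} (hu : ‖u‖ < 1)
    (hv : ‖v‖ < 1) : Summable fun k : ℕ × ℕ => f k.1 k.2 * u ^ k.1 * v ^ k.2 := by
  obtain ⟨C, K, hC⟩ := hf
  refine .of_norm_bounded (summable_poly_mul_geometric₂ (norm_nonneg u) hu (norm_nonneg v) hv C K)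
    fun k => ?_
  rw [norm_mul, norm_mul, norm_pow, norm_pow, mul_assoc]
  gcongr
  exact hC _ _

theorem PolyGrowth₂.differentiableOn {f : ℕ → ℕ → ℂ} (hf : PolyGrowth₂ f) :
    DifferentiableOn ℂ (fun P : ℂ × ℂ => ∑' k : ℕ × ℕ, f k.1 k.2 * P.1 ^ k.1 * P.2 ^ k.2)
      (Metric.ball 0 1) := by
  intro P hP
  obtain ⟨r, hPr, hr1⟩ := exists_between (mem_ball_zero_iff.1 hP)
  have hr0 : 0 < r := (norm_nonneg P).trans_lt hPr
  have hsum : Summable fun k : ℕ × ℕ => f k.1 k.2 * P.1 ^ k.1 * P.2 ^ k.2 :=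
    hf.summable (((norm_fst_le P).trans_lt hPr).trans hr1)
      (((norm_snd_le P).trans_lt hPr).trans hr1)
  obtain ⟨C, K, hC⟩ := hf
  let f' : ℕ × ℕ → ℂ × ℂ → (ℂ × ℂ →L[ℂ] ℂ) := fun k Q =>
    f k.1 k.2 • (Q.1 ^ k.1 • ((k.2 : ℂ) * Q.2 ^ (k.2 - 1)) • ContinuousLinearMap.snd ℂ ℂ ℂ +
      Q.2 ^ k.2 • ((k.1 : ℂ) * Q.1 ^ (k.1 - 1)) • ContinuousLinearMap.fst ℂ ℂ ℂ)
  have hf' : ∀ (k : ℕ × ℕ) (Q : ℂ × ℂ), Q ∈ Metric.ball (0 : ℂ × ℂ) r →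
      HasFDerivAt (fun Q : ℂ × ℂ => f k.1 k.2 * Q.1 ^ k.1 * Q.2 ^ k.2) (f' k Q) Q := by
    intro k Q _
    have h1 : HasFDerivAt (fun Q : ℂ × ℂ => Q.1 ^ k.1)
        (((k.1 : ℂ) * Q.1 ^ (k.1 - 1)) • ContinuousLinearMap.fst ℂ ℂ ℂ) Q :=
      (hasDerivAt_pow k.1 Q.1).comp_hasFDerivAt Q hasFDerivAt_fst
    have h2 : HasFDerivAt (fun Q : ℂ × ℂ => Q.2 ^ k.2)
        (((k.2 : ℂ) * Q.2 ^ (k.2 - 1)) • ContinuousLinearMap.snd ℂ ℂ ℂ) Q :=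
      (hasDerivAt_pow k.2 Q.2).comp_hasFDerivAt Q hasFDerivAt_snd
    simpa only [mul_assoc, Pi.mul_apply, smul_eq_mul] using ((h1.mul h2).const_mul (f k.1 k.2))
  have hpow : ∀ (z : ℂ) (n : ℕ), ‖z‖ < r → ‖(n : ℂ) * z ^ (n - 1)‖ ≤ n * r ^ n / r := by
    intro z n hz
    rcases n with _ | n
    · simp
    · rw [norm_mul, norm_pow, Complex.norm_natCast, Nat.add_sub_cancel, pow_succ, mul_div_assoc,
        mul_div_cancel_right₀ _ hr0.ne']
      gcongr
  have hb : ∀ (k : ℕ × ℕ) (Q : ℂ × ℂ), Q ∈ Metric.ball (0 : ℂ × ℂ) r →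
      ‖f' k Q‖ ≤ C / r * 2 * ((k.1 + 1 : ℝ) * (k.2 + 1)) ^ (K + 1) * (r ^ k.1 * r ^ k.2) := by
    rintro ⟨m, n⟩ Q hQ
    have hQ' := mem_ball_zero_iff.1 hQ
    have q1 := (norm_fst_le Q).trans_lt hQ'
    have q2 := (norm_snd_le Q).trans_lt hQ'
    have hC0 : 0 ≤ C := by simpa using (norm_nonneg _).trans (hC 0 0)
    have s1 : ‖Q.1 ^ m • ((n : ℂ) * Q.2 ^ (n - 1)) • ContinuousLinearMap.snd ℂ ℂ ℂ‖ ≤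
        r ^ m * (n * r ^ n / r) := by
      rw [norm_smul, norm_smul, norm_pow]
      calc _ ≤ r ^ m * ((n * r ^ n / r) * 1) := by
            gcongr
            exacts [hpow _ _ q2, ContinuousLinearMap.norm_snd_le ℂ ℂ ℂ]
        _ = _ := by ring
    have s2 : ‖Q.2 ^ n • ((m : ℂ) * Q.1 ^ (m - 1)) • ContinuousLinearMap.fst ℂ ℂ ℂ‖ ≤
        r ^ n * (m * r ^ m / r) := by
      rw [norm_smul, norm_smul, norm_pow]
      calc _ ≤ r ^ n * ((m * r ^ m / r) * 1) := by
            gcongr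
            exacts [hpow _ _ q1, ContinuousLinearMap.norm_fst_le ℂ ℂ ℂ]
        _ = _ := by ring
    have s3 : (m + n : ℝ) ≤ 2 * ((m + 1 : ℝ) * (n + 1)) := by
      nlinarith [mul_nonneg (m.cast_nonneg (α := ℝ)) (n.cast_nonneg (α := ℝ)),
        m.cast_nonneg (α := ℝ), n.cast_nonneg (α := ℝ)]
    simp only [f']
    rw [norm_smul]
    calc _ ≤ C * ((m + 1 : ℝ) * (n + 1)) ^ K *
          (r ^ m * (n * r ^ n / r) + r ^ n * (m * r ^ m / r)) := by
          gcongr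
          exacts [hC m n, (norm_add_le _ _).trans (add_le_add s1 s2)]
      _ = C * ((m + 1 : ℝ) * (n + 1)) ^ K * (r ^ m * r ^ n / r) * (m + n) := by ring
      _ ≤ C * ((m + 1 : ℝ) * (n + 1)) ^ K * (r ^ m * r ^ n / r) *
          (2 * ((m + 1 : ℝ) * (n + 1))) := by gcongr
      _ = _ := by rw [pow_succ]; ring
  have hPr' : P ∈ Metric.ball (0 : ℂ × ℂ) r := mem_ball_zero_iff.2 hPr
  exact (hasFDerivAt_tsum_of_isPreconnected
    (summable_poly_mul_geometric₂ hr0.le hr1 hr0.le hr1 (C / r * 2) (K + 1)) Metric.isOpen_ball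
    (convex_ball _ _).isPreconnected hf' hb hPr' hsum hPr').differentiableAt.differentiableWithinAt

/-! ### Pfaff's transformation -/

/-- The **Chu–Vandermonde identity**. -/
theorem sum_choose_mul_poch_div_poch (d : ℂ) {c : ℂ} (hc : ∀ k : ℕ, c ≠ -k) (N : ℕ) :
    ∑ ij ∈ Finset.HasAntidiagonal.antidiagonal N,
      (N.choose ij.1 : ℂ) * ((-1) ^ ij.1 * poch d ij.1 / poch c ij.1) =
      poch (c - d) N / poch c N := by
  induction N generalizing c d with
  | zero => simp
  | succ N ih =>
    have hc1 : ∀ k : ℕ, c + 1 ≠ -k := fun k h => hc (k + 1) (by push_cast; linear_combination h)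
    have h0 : c ≠ 0 := by simpa using hc 0
    have hN : c + N ≠ 0 := fun h => hc N (eq_neg_of_add_eq_zero_left h)
    rw [Finset.sum_antidiagonal_choose_succ_mul
      (fun i _ => (-1) ^ i * poch d i / poch c i), ih d hc]
    have e : ∑ ij ∈ Finset.HasAntidiagonal.antidiagonal N, (N.choose ij.2 : ℂ) *
        ((-1) ^ (ij.1 + 1) * poch d (ij.1 + 1) / poch c (ij.1 + 1)) =
        -(d / c) * (poch (c - d) N / poch (c + 1) N) := by
      rw [show c - d = c + 1 - (d + 1) by ring, ← ih (d + 1) hc1, Finset.mul_sum]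
      refine Finset.sum_congr rfl fun ij hij => ?_
      rw [Finset.HasAntidiagonal.mem_antidiagonal] at hij
      rw [poch_succ_left, poch_succ_left, ← Nat.choose_symm_of_eq_add hij.symm]
      have := poch_ne_zero hc1 ij.1
      field_simp
      ring
    rw [e]
    have h1 := poch_ne_zero hc N
    have h2 : poch (c + 1) N = (c + N) * poch c N / c := by
      rw [← mul_poch_add_one]; field_simp
    rw [h2, poch_succ, poch_succ]
    field_simp
    ring

theorem hasSum_poch_div_factorial (a : ℂ) {v : ℂ} (hv : ‖v‖ < 1) :
    HasSum (fun n : ℕ => poch a n / (n.factorial : ℂ) * v ^ n) ((1 - v) ^ (-a)) := by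
  have hv' : v ∈ Metric.eball (0 : ℂ) 1 := by
    rw [← ENNReal.ofReal_one, Metric.eball_ofReal]; simpa using hv
  have h := (Complex.one_div_one_sub_cpow_hasFPowerSeriesOnBall_zero a).hasSum hv'
  rw [zero_add, one_div, ← Complex.cpow_neg] at h
  refine h.congr_fun fun n => ?_
  have e : Ring.choose (a + n - 1) n = poch a n / (n.factorial : ℂ) := by
    rw [← Ring.multichoose_eq, eq_div_iff (by exact_mod_cast n.factorial_ne_zero),
      ← nsmul_eq_mul', Ring.factorial_nsmul_multichoose_eq_ascPochhammer,
      Polynomial.ascPochhammer_smeval_cast, Polynomial.ascPochhammer_smeval_eq_eval, poch]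
  simp [FormalMultilinearSeries.ofScalars, e]

theorem cast_choose_mul_factorial_mul_factorial (m n : ℕ) :
    ((m + n).choose m : ℂ) * (m.factorial * n.factorial) = (m + n).factorial := by
  have := Nat.choose_mul_factorial_mul_factorial (Nat.le_add_right m n)
  rw [Nat.add_sub_cancel_left] at this
  rw [← mul_assoc]
  exact_mod_cast this

theorem choose_le_two_pow_add (m n : ℕ) : ((m + n).choose m : ℝ) ≤ 2 ^ m * 2 ^ n := by
  rw [← pow_add]
  exact_mod_cast Nat.choose_le_two_pow (m + n) m

/-- **Pfaff's transformation** of the hypergeometric series near the origin. -/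
theorem tsum_pfaff (a b : ℂ) {c v : ℂ} (hc : ∀ k : ℕ, c ≠ -k) (hv : ‖v‖ < 1 / 2) :
    ∑' n : ℕ, poch a n * poch b n / (poch c n * (n.factorial : ℂ)) * v ^ n =
      (1 - v) ^ (-a) * ∑' n : ℕ, poch a n * poch (c - b) n / (poch c n * (n.factorial : ℂ)) *
        (v / (v - 1)) ^ n := by
  have hv1 : ‖v‖ < 1 := by linarith
  have hv0 : (1 - v) ≠ 0 := by
    intro h
    rw [← sub_eq_zero.1 h] at hv1
    simp at hv1
  let φ : ℕ × ℕ → ℂ := fun k => (poch a k.1 * poch (c - b) k.1 /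
    (poch c k.1 * (k.1.factorial : ℂ)) * (-v) ^ k.1) *
      (poch (a + k.1) k.2 / (k.2.factorial : ℂ) * v ^ k.2)
  have hφ : Summable φ := by
    have hg : PolyGrowth₂ fun m n => (poch a (m + n) / ((m + n).factorial : ℂ)) *
        (poch (c - b) m / (m.factorial : ℂ)) * ((m.factorial : ℂ) / poch c m) *
        ((-1) ^ m * ((m + n).choose m : ℂ) / (2 ^ m * 2 ^ n)) := by
      refine (((PolyGrowth.poch_div a).add.mul (PolyGrowth.poch_div (c - b)).fst).mul
        (PolyGrowth.div_poch hc).fst).mul (.of_norm_le_one fun m n => ?_)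
      have := choose_le_two_pow_add m n
      simp only [norm_div, norm_mul, norm_pow, norm_neg, norm_one, one_pow, one_mul,
        Complex.norm_natCast, Complex.norm_ofNat]
      rwa [div_le_one (by positivity)]
    have h2v : ‖2 * v‖ < 1 := by
      rw [norm_mul, Complex.norm_ofNat]; linarith
    refine (hg.summable h2v h2v).congr fun k => ?_
    obtain ⟨m, n⟩ := k
    have h1 : (m.factorial : ℂ) ≠ 0 := by exact_mod_cast m.factorial_ne_zero
    have h2 : (n.factorial : ℂ) ≠ 0 := by exact_mod_cast n.factorial_ne_zero
    have h3 : ((m + n).factorial : ℂ) ≠ 0 := by exact_mod_cast (m + n).factorial_ne_zero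
    have h4 := poch_ne_zero hc m
    have h5 := cast_choose_mul_factorial_mul_factorial m n
    have h6 : ((m + n).choose m : ℂ) = (m + n).factorial / (m.factorial * n.factorial) := by
      rw [← h5]; field_simp
    simp only [φ]
    rw [h6, poch_add, mul_pow, mul_pow, neg_pow v]
    field_simp
  have h1 : ∀ m : ℕ, ∑' n : ℕ, φ (m, n) = (1 - v) ^ (-a) *
      (poch a m * poch (c - b) m / (poch c m * (m.factorial : ℂ)) * (v / (v - 1)) ^ m) := by
    intro m
    simp only [φ]
    rw [tsum_mul_left, (hasSum_poch_div_factorial (a + m) hv1).tsum_eq, neg_add,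
      Complex.cpow_add _ _ hv0, Complex.cpow_neg _ (m : ℂ), Complex.cpow_natCast,
      show v / (v - 1) = -v / (1 - v) by rw [← neg_sub, div_neg, neg_div], div_pow]
    field_simp
  have h2 : ∀ N : ℕ, ∑ ij ∈ Finset.HasAntidiagonal.antidiagonal N, φ ij =
      poch a N * poch b N / (poch c N * (N.factorial : ℂ)) * v ^ N := by
    intro N
    have h := sum_choose_mul_poch_div_poch (c - b) hc N
    rw [sub_sub_cancel] at h
    have hN : (N.factorial : ℂ) ≠ 0 := by exact_mod_cast N.factorial_ne_zero
    have e : poch a N * poch b N / (poch c N * (N.factorial : ℂ)) * v ^ N =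
        poch a N * v ^ N / (N.factorial : ℂ) * (poch b N / poch c N) := by
      have := poch_ne_zero hc N
      field_simp
    rw [e, ← h, Finset.mul_sum]
    refine Finset.sum_congr rfl fun ij hij => ?_
    obtain ⟨m, n⟩ := ij
    rw [Finset.HasAntidiagonal.mem_antidiagonal] at hij
    subst hij
    have h1 : (m.factorial : ℂ) ≠ 0 := by exact_mod_cast m.factorial_ne_zero
    have h2 : (n.factorial : ℂ) ≠ 0 := by exact_mod_cast n.factorial_ne_zero
    have h4 := poch_ne_zero hc m
    have h5 := cast_choose_mul_factorial_mul_factorial m n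
    simp only [φ]
    rw [poch_add, neg_pow v, pow_add, ← h5]
    have h6 : ((m + n).choose m : ℂ) ≠ 0 := by
      exact_mod_cast (Nat.choose_pos (Nat.le_add_right m n)).ne'
    field_simp
  calc _ = ∑' N : ℕ, ∑ ij ∈ Finset.HasAntidiagonal.antidiagonal N, φ ij := by simp only [h2]
    _ = ∑' k, φ k := by
      have hs := Finset.HasAntidiagonal.sigmaAntidiagonalEquivProd.summable_iff.2 hφ
      have ht := hs.tsum_sigma' fun n => (hasSum_fintype _).summable
      rw [← Finset.HasAntidiagonal.sigmaAntidiagonalEquivProd.tsum_eq φ]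
      refine Eq.trans ?_ ht.symm
      congr 1 with N
      rw [tsum_fintype, ← Finset.sum_coe_sort]
      rfl
    _ = _ := by
      rw [hφ.tsum_prod, ← tsum_mul_left]
      simp only [h1]

/-! ### The continuation of Appell's series -/

/-- The coefficients of the double series obtained from Appell's series by applying Pfaff's
transformation to its inner sum over `n`. -/
noncomputable def pfaffCoeff (α α' β β' γ : ℂ) (m n : ℕ) : ℂ :=
  poch α m * poch β m * poch α' n * poch (γ - β' + m) n /
    (poch γ (m + n) * (m.factorial : ℂ) * (n.factorial : ℂ))

theorem polyGrowth_pfaffCoeff (α α' β β' : ℂ) {γ : ℂ} (hγ : ∀ k : ℕ, γ ≠ -k) :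
    PolyGrowth₂ (pfaffCoeff α α' β β' γ) := by
  have h := ((((PolyGrowth.poch_div α).fst.mul (PolyGrowth.poch_div β).fst).mul
    (PolyGrowth.poch_div α').snd).mul (PolyGrowth₂.poch_shift (γ - β'))).mul
    (PolyGrowth.div_poch hγ).add
  convert h using 3 with m n
  have h1 : (m.factorial : ℂ) ≠ 0 := by exact_mod_cast m.factorial_ne_zero
  have h2 : (n.factorial : ℂ) ≠ 0 := by exact_mod_cast n.factorial_ne_zero
  have h3 : ((m + n).factorial : ℂ) ≠ 0 := by exact_mod_cast (m + n).factorial_ne_zero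
  have h4 := poch_ne_zero hγ (m + n)
  rw [pfaffCoeff]
  field_simp

theorem polyGrowth_appellF3_coeff (α α' β β' : ℂ) {γ : ℂ} (hγ : ∀ k : ℕ, γ ≠ -k) :
    PolyGrowth₂ fun m n => poch α m * poch α' n * poch β m * poch β' n /
      (poch γ (m + n) * (m.factorial : ℂ) * (n.factorial : ℂ)) := by
  have h0 : PolyGrowth₂ fun m n => (((m + n).choose m : ℕ) : ℂ)⁻¹ := by
    refine .of_norm_le_one fun m n => ?_
    rw [norm_inv, Complex.norm_natCast]
    exact inv_le_one_of_one_le₀ (by exact_mod_cast Nat.choose_pos (Nat.le_add_right m n))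
  have h := ((((((PolyGrowth.poch_div α).fst.mul (PolyGrowth.poch_div β).fst).mul
    (PolyGrowth.poch_div α').snd).mul (PolyGrowth.poch_div β').snd)).mul
    (PolyGrowth.div_poch hγ).add).mul h0
  convert h using 3 with m n
  have h1 : (m.factorial : ℂ) ≠ 0 := by exact_mod_cast m.factorial_ne_zero
  have h2 : (n.factorial : ℂ) ≠ 0 := by exact_mod_cast n.factorial_ne_zero
  have h3 : ((m + n).factorial : ℂ) ≠ 0 := by exact_mod_cast (m + n).factorial_ne_zero
  have h4 := poch_ne_zero hγ (m + n)
  have h5 := cast_choose_mul_factorial_mul_factorial m n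
  have h6 : (((m + n).choose m : ℕ) : ℂ)⁻¹ = m.factorial * n.factorial / (m + n).factorial := by
    have h7 : ((m + n).choose m : ℂ) ≠ 0 := by
      exact_mod_cast (Nat.choose_pos (Nat.le_add_right m n)).ne'
    rw [← h5]; field_simp
  rw [h6]
  field_simp

/-- Rewriting Appell's series by Pfaff's transformation in its second variable. -/
theorem appellF3Series_eq_pfaff (α α' β β' : ℂ) {γ u v : ℂ} (hγ : ∀ k : ℕ, γ ≠ -k)
    (hu : ‖u‖ < 1) (hv : ‖v‖ < 1 / 2) (hz : ‖v / (v - 1)‖ < 1) :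
    appellF3Series α α' β β' γ (u, v) = (1 - v) ^ (-α') *
      ∑' k : ℕ × ℕ, pfaffCoeff α α' β β' γ k.1 k.2 * u ^ k.1 * (v / (v - 1)) ^ k.2 := by
  have hv1 : ‖v‖ < 1 := by linarith
  have s1 := (polyGrowth_appellF3_coeff α α' β β' hγ).summable hu hv1
  have s2 := (polyGrowth_pfaffCoeff α α' β β' hγ).summable hu hz
  rw [appellF3Series, s1.tsum_prod, s2.tsum_prod, ← tsum_mul_left]
  congr 1 with m
  have hm : ∀ k : ℕ, γ + m ≠ -k := fun k h =>
    hγ (m + k) (by push_cast; linear_combination h)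
  have e1 : ∀ n : ℕ, poch α m * poch α' n * poch β m * poch β' n /
      (poch γ (m + n) * (m.factorial : ℂ) * (n.factorial : ℂ)) * u ^ m * v ^ n =
      poch α m * poch β m / (poch γ m * (m.factorial : ℂ)) * u ^ m *
        (poch α' n * poch β' n / (poch (γ + m) n * (n.factorial : ℂ)) * v ^ n) := by
    intro n
    rw [poch_add]
    ring
  have e2 : ∀ n : ℕ, pfaffCoeff α α' β β' γ m n * u ^ m * (v / (v - 1)) ^ n =
      poch α m * poch β m / (poch γ m * (m.factorial : ℂ)) * u ^ m *
        (poch α' n * poch (γ + m - β') n / (poch (γ + m) n * (n.factorial : ℂ)) *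
          (v / (v - 1)) ^ n) := by
    intro n
    rw [pfaffCoeff, poch_add, show γ + m - β' = γ - β' + m by ring]
    ring
  simp only [e1, e2]
  rw [tsum_mul_left, tsum_mul_left, tsum_pfaff α' β' hm hv]
  ring

theorem norm_div_sub_one_lt_one {v : ℂ} (hv : v.re < 1 / 2) : ‖v / (v - 1)‖ < 1 := by
  have h1 : v - 1 ≠ 0 := by
    intro h
    rw [sub_eq_zero.1 h] at hv
    norm_num at hv
  rw [norm_div, div_lt_one (norm_pos_iff.2 h1), Complex.norm_def, Complex.norm_def]
  refine Real.sqrt_lt_sqrt (Complex.normSq_nonneg _) ?_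
  simp only [Complex.normSq_apply, Complex.sub_re, Complex.sub_im, Complex.one_re, Complex.one_im]
  nlinarith

/-- The transformed series continues Appell's series to `|u| < 1`, `Re v < 1 / 2`. -/
theorem isAppellF3Continuation_pfaff (α α' β β' : ℂ) {γ : ℂ} (hγ : ∀ k : ℕ, γ ≠ -k) :
    IsAppellF3Continuation α α' β β' γ {P : ℂ × ℂ | ‖P.1‖ < 1 ∧ P.2.re < 1 / 2}
      fun P => (1 - P.2) ^ (-α') * ∑' k : ℕ × ℕ, pfaffCoeff α α' β β' γ k.1 k.2 * P.1 ^ k.1 *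
        (P.2 / (P.2 - 1)) ^ k.2 where
  isOpen := (isOpen_lt (f := fun P : ℂ × ℂ => ‖P.1‖) (by fun_prop) continuous_const).inter
    (isOpen_lt (Complex.continuous_re.comp continuous_snd) continuous_const)
  starConvex := by
    have h1 : Convex ℝ {P : ℂ × ℂ | ‖P.1‖ < 1} := by
      have := (convex_ball (0 : ℂ) 1).linear_preimage (LinearMap.fst ℝ ℂ ℂ)
      have e : {P : ℂ × ℂ | ‖P.1‖ < 1} = LinearMap.fst ℝ ℂ ℂ ⁻¹' Metric.ball (0 : ℂ) 1 := by
        ext P; simp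
      rw [e]; exact this
    have h2 : Convex ℝ {P : ℂ × ℂ | P.2.re < 1 / 2} :=
      (convex_Iio (1 / 2 : ℝ)).linear_preimage (Complex.reLm ∘ₗ LinearMap.snd ℝ ℂ ℂ)
    exact (h1.inter h2).starConvex (by simp)
  differentiableOn := by
    have hne : ∀ P ∈ {P : ℂ × ℂ | ‖P.1‖ < 1 ∧ P.2.re < 1 / 2}, P.2 - 1 ≠ 0 := by
      intro P hP h
      have := hP.2
      rw [sub_eq_zero.1 h] at this
      norm_num at this
    have h1 : DifferentiableOn ℂ (fun P : ℂ × ℂ => (1 - P.2) ^ (-α'))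
        {P : ℂ × ℂ | ‖P.1‖ < 1 ∧ P.2.re < 1 / 2} := by
      refine DifferentiableOn.cpow (by fun_prop) (by fun_prop) fun P hP => ?_
      refine Or.inl ?_
      have := hP.2
      simp only [Complex.sub_re, Complex.one_re]
      linarith
    have h2 : DifferentiableOn ℂ (fun P : ℂ × ℂ => (P.1, P.2 / (P.2 - 1)))
        {P : ℂ × ℂ | ‖P.1‖ < 1 ∧ P.2.re < 1 / 2} := by
      simp only [div_eq_mul_inv]
      exact DifferentiableOn.prodMk (by fun_prop)
        (DifferentiableOn.mul (by fun_prop) (DifferentiableOn.inv (by fun_prop) hne))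
    refine h1.mul ((polyGrowth_pfaffCoeff α α' β β' hγ).differentiableOn.comp h2 fun P hP => ?_)
    rw [mem_ball_zero_iff, Prod.norm_def, max_lt_iff]
    exact ⟨hP.1, norm_div_sub_one_lt_one hP.2⟩
  eq_series := by
    filter_upwards [Metric.ball_mem_nhds (0 : ℂ × ℂ) (show (0 : ℝ) < 1 / 2 by norm_num)] with P hP
    rw [mem_ball_zero_iff] at hP
    have h1 := (norm_fst_le P).trans_lt hP
    have h2 := (norm_snd_le P).trans_lt hP
    exact (appellF3Series_eq_pfaff α α' β β' hγ (u := P.1) (v := P.2) (by linarith) h2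
      (norm_div_sub_one_lt_one ((Complex.re_le_norm _).trans_lt h2))).symm

/-- The transformed double series on the curve `u + v = u v`, where both of its arguments `u` and
`v / (v - 1)` take the same value `w`. -/
noncomputable def pfaffSeries (α α' β β' γ w : ℂ) : ℂ :=
  ∑' k : ℕ × ℕ, pfaffCoeff α α' β β' γ k.1 k.2 * w ^ k.1 * w ^ k.2

theorem appellF3_eq_pfaffSeries (α α' β β' : ℂ) {γ : ℂ} (hγ : ∀ k : ℕ, γ ≠ -k) {w : ℝ}
    (hw : w ∈ Ioo (0 : ℝ) 1) :
    appellF3 α α' β β' γ w (1 - 1 / (1 - w)) =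
      (1 - w : ℂ) ^ α' * pfaffSeries α α' β β' γ w := by
  have hw1 : 0 < 1 - w := by linarith [hw.2]
  have hc : (1 - w : ℂ) ≠ 0 := by exact_mod_cast hw1.ne'
  have hw0 : (w : ℂ) ≠ 0 := by exact_mod_cast hw.1.ne'
  have hre : (1 - 1 / (1 - w) : ℂ).re < 1 / 2 := by
    have e : (1 - 1 / (1 - w) : ℂ) = ((1 - 1 / (1 - w) : ℝ) : ℂ) := by push_cast; rfl
    rw [e, Complex.ofReal_re]
    have : 1 < 1 / (1 - w) := by rw [lt_div_iff₀ hw1]; linarith [hw.1]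
    linarith
  have hn : ‖(w : ℂ)‖ < 1 := by
    rw [Complex.norm_real, Real.norm_of_nonneg hw.1.le]; exact hw.2
  rw [(isAppellF3Continuation_pfaff α α' β β' hγ).appellF3_eq (u := (w : ℂ))
    (v := 1 - 1 / (1 - w)) ⟨hn, hre⟩]
  simp only
  have e1 : (1 - (1 - 1 / (1 - w)) : ℂ) = (1 - w : ℂ)⁻¹ := by ring
  have e2 : ((1 - 1 / (1 - w)) / (1 - 1 / (1 - w) - 1) : ℂ) = w := by
    field_simp
    ring
  have harg : (1 - w : ℂ).arg ≠ Real.pi := by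
    have : (1 - w : ℂ) = ((1 - w : ℝ) : ℂ) := by push_cast; rfl
    rw [this, Complex.arg_ofReal_of_nonneg hw1.le]
    exact Real.pi_ne_zero.symm
  rw [e1, e2, Complex.inv_cpow _ _ harg, Complex.cpow_neg, inv_inv, pfaffSeries]

/-- The contiguous relation that raises `α'`. -/
theorem pfaffSeries_contiguous (α α' β β' : ℂ) {γ : ℂ} (hγ : 0 < γ.re) {w : ℂ} (hw : ‖w‖ < 1) :
    pfaffSeries α α' β β' γ w = (1 - w) * pfaffSeries α (α' + 1) β β' γ w +
      β' / γ * w * pfaffSeries α (α' + 1) β (β' + 1) (γ + 1) w := by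
  have hγ1 : 0 < (γ + 1).re := by simp; linarith
  have s1 := ((polyGrowth_pfaffCoeff α (α' + 1) β β'
    (ne_neg_natCast_of_re_pos hγ)).summable hw hw).hasSum
  have s2 := ((polyGrowth_pfaffCoeff α (α' + 1) β (β' + 1)
    (ne_neg_natCast_of_re_pos hγ1)).summable hw hw).hasSum
  set c₁ := pfaffCoeff α (α' + 1) β β' γ
  set c₂ := pfaffCoeff α (α' + 1) β (β' + 1) (γ + 1)
  have s3 := (s2.mul_left (β' / γ * w)).sub (s1.mul_left w)
  let g : ℕ × ℕ → ℂ := fun k => pfaffCoeff α α' β β' γ k.1 k.2 * w ^ k.1 * w ^ k.2 -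
    c₁ k.1 k.2 * w ^ k.1 * w ^ k.2
  let i : ℕ × ℕ → ℕ × ℕ := fun k => (k.1, k.2 + 1)
  have hi : Function.Injective i := by
    rintro ⟨a, b⟩ ⟨c, d⟩ h
    simpa [i] using h
  have hg : HasSum g (β' / γ * w * pfaffSeries α (α' + 1) β (β' + 1) (γ + 1) w -
      w * pfaffSeries α (α' + 1) β β' γ w) := by
    rw [← hi.hasSum_iff]
    · refine s3.congr_fun fun k => ?_
      obtain ⟨m, n⟩ := k
      have h1 := poch_ne_zero_of_re_pos hγ (m + n)
      have h2 : (n.factorial : ℂ) ≠ 0 := by exact_mod_cast n.factorial_ne_zero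
      have h3 : (n + 1 : ℂ) ≠ 0 := by exact_mod_cast n.succ_ne_zero
      have h4 : γ ≠ 0 := fun h => by simp [h] at hγ
      have h5 : γ + (m + n : ℕ) ≠ 0 := fun h =>
        ne_neg_natCast_of_re_pos hγ _ (eq_neg_of_add_eq_zero_left h)
      have h6 : poch (γ + 1) (m + n) = (γ + (m + n : ℕ)) * poch γ (m + n) / γ := by
        rw [← mul_poch_add_one]; field_simp
      have h7 : (m.factorial : ℂ) ≠ 0 := by exact_mod_cast m.factorial_ne_zero
      simp only [g, i, c₁, c₂, Function.comp_apply, pfaffCoeff, h6, ← add_assoc m n 1,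
        Nat.factorial_succ, poch_succ_left α' n, poch_succ (α' + 1) n, poch_succ _ n,
        poch_succ _ (m + n), show γ + 1 - (β' + 1) + m = γ - β' + m by ring]
      push_cast at h5 ⊢
      field_simp
      ring
    · rintro ⟨m, n⟩ hmn
      rcases n with _ | n
      · simp [g, c₁, pfaffCoeff]
      · exact absurd ⟨(m, n), rfl⟩ hmn
  have h0 := hg.add s1
  simp only [g, sub_add_cancel] at h0
  rw [pfaffSeries, h0.tsum_eq, pfaffSeries, pfaffSeries]
  ring

/-! ### A Beta integral of the transformed series -/

theorem integrable_tsum_of_summable_integral_norm {X ι E : Type*} [MeasurableSpace X]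
    {μ : Measure X} [Countable ι] [NormedAddCommGroup E] [CompleteSpace E] {F : ι → X → E}
    (hF : ∀ i, Integrable (F i) μ) (hs : Summable fun i => ∫ x, ‖F i x‖ ∂μ) :
    Integrable (fun x => ∑' i, F i x) μ := by
  have h1 : ∫⁻ x, ∑' i, ‖F i x‖ₑ ∂μ ≠ ⊤ := by
    rw [lintegral_tsum fun i => (hF i).1.enorm]
    have e : ∀ i, ∫⁻ x, ‖F i x‖ₑ ∂μ = ENNReal.ofReal (∫ x, ‖F i x‖ ∂μ) := fun i => by
      rw [ofReal_integral_norm_eq_lintegral_enorm (hF i)]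
    simp only [e]
    exact hs.tsum_ofReal_ne_top
  have hm : AEMeasurable (fun x => ∑' i, ‖F i x‖ₑ) μ :=
    AEMeasurable.tsum fun i => (hF i).1.enorm
  have h2 : ∀ᵐ x ∂μ, Summable fun i => F i x := by
    filter_upwards [ae_lt_top' hm h1] with x hx
    exact Summable.of_nnnorm (ENNReal.tsum_coe_ne_top_iff_summable.1 hx.ne)
  refine ⟨?_, ?_⟩
  · refine aestronglyMeasurable_of_tendsto_ae atTop
      (f := fun (s : Finset ι) x => ∑ i ∈ s, F i x)
      (fun s => Finset.aestronglyMeasurable_fun_sum s fun i _ => (hF i).1) ?_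
    filter_upwards [h2] with x hx using hx.hasSum
  · refine lt_of_le_of_lt (lintegral_mono fun x => ?_) (lt_top_iff_ne_top.2 h1)
    exact enorm_tsum_le_tsum_enorm

theorem integrableOn_beta {u v : ℂ} (hu : 0 < u.re) (hv : 0 < v.re) :
    IntegrableOn (fun w : ℝ => (w : ℂ) ^ (u - 1) * (1 - w : ℂ) ^ (v - 1)) (Ioo 0 1) :=
  ((intervalIntegrable_iff_integrableOn_Ioo_of_le zero_le_one).1
    (Complex.betaIntegral_convergent hu hv))

theorem setIntegral_beta {u v : ℂ} (hu : 0 < u.re) (hv : 0 < v.re) :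
    ∫ w in Ioo (0 : ℝ) 1, (w : ℂ) ^ (u - 1) * (1 - w : ℂ) ^ (v - 1) =
      Complex.Gamma u * Complex.Gamma v * (Complex.Gamma (u + v))⁻¹ := by
  rw [← div_eq_mul_inv, ← Complex.betaIntegral_eq_Gamma_mul_div u v hu hv, Complex.betaIntegral,
    intervalIntegral.integral_of_le zero_le_one, integral_Ioc_eq_integral_Ioo]

theorem setIntegral_norm_beta {u v : ℂ} (hu : 0 < u.re) (hv : 0 < v.re) :
    ∫ w in Ioo (0 : ℝ) 1, ‖(w : ℂ) ^ (u - 1) * (1 - w : ℂ) ^ (v - 1)‖ =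
      ‖Complex.Gamma u.re * Complex.Gamma v.re * (Complex.Gamma (u.re + v.re))⁻¹‖ := by
  have h := setIntegral_beta (u := u.re) (v := v.re) (by simpa) (by simpa)
  have e : ∀ w ∈ Ioo (0 : ℝ) 1, (w : ℂ) ^ ((u.re : ℂ) - 1) * (1 - w : ℂ) ^ ((v.re : ℂ) - 1) =
      ((‖(w : ℂ) ^ (u - 1) * (1 - w : ℂ) ^ (v - 1)‖ : ℝ) : ℂ) := by
    intro w hw
    have h1 : 0 < 1 - w := by linarith [hw.2]
    have h2 : (1 - w : ℂ) = ((1 - w : ℝ) : ℂ) := by push_cast; rfl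
    rw [norm_mul, h2, Complex.norm_cpow_eq_rpow_re_of_pos hw.1,
      Complex.norm_cpow_eq_rpow_re_of_pos h1, Complex.ofReal_mul, Complex.ofReal_cpow hw.1.le,
      Complex.ofReal_cpow h1.le]
    simp
  rw [setIntegral_congr_fun measurableSet_Ioo e, integral_complex_ofReal] at h
  rw [← h, Complex.norm_real, Real.norm_of_nonneg]
  exact integral_nonneg fun _ => norm_nonneg _

/-- A double series that converges because its exponents are controlled in each variable
separately and jointly. -/
theorem summable_rpow_mul_rpow_mul_rpow_add {B E a : ℝ} (hB : 0 < B) (hE : 0 < E) (ha : 0 < a) :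
    Summable fun k : ℕ × ℕ => (k.1 + 1 : ℝ) ^ (B - E - 1) * (k.2 + 1 : ℝ) ^ (a - 1) *
      (k.1 + k.2 + 1 : ℝ) ^ (-B - a) := by
  -- The joint factor is split as `(m + 1) ^ (-s) * (n + 1) ^ (s - B - a)` with `B - E < s < B`.
  set s := max 0 (B - E / 2) with hs
  have hs0 : 0 ≤ s := le_max_left _ _
  have hsB : s < B := max_lt hB (by linarith)
  have hsE : B - E < s := lt_of_lt_of_le (by linarith) (le_max_right _ _)
  have h1 := summable_add_one_rpow (e := B - E - 1 - s) (by linarith)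
  have h2 := summable_add_one_rpow (e := a - 1 - (B + a - s)) (by linarith)
  refine .of_nonneg_of_le (fun k => by positivity) (fun k => ?_)
    (h1.mul_of_nonneg h2 (fun n => by positivity) (fun n => by positivity))
  obtain ⟨m, n⟩ := k
  have hm : (0 : ℝ) < m + 1 := by positivity
  have hn : (0 : ℝ) < n + 1 := by positivity
  have hmn : (0 : ℝ) < m + n + 1 := by positivity
  have e1 : (m + n + 1 : ℝ) ^ (-s) ≤ (m + 1 : ℝ) ^ (-s) :=
    Real.rpow_le_rpow_of_nonpos hm (by linarith) (by linarith)
  have e2 : (m + n + 1 : ℝ) ^ (-(B + a - s)) ≤ (n + 1 : ℝ) ^ (-(B + a - s)) :=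
    Real.rpow_le_rpow_of_nonpos hn (by linarith) (by linarith)
  simp only
  rw [show -B - a = -s + -(B + a - s) by ring, Real.rpow_add hmn,
    sub_eq_add_neg (B - E - 1) s, sub_eq_add_neg (a - 1) (B + a - s), Real.rpow_add hm,
    Real.rpow_add hn]
  calc _ ≤ (m + 1 : ℝ) ^ (B - E - 1) * (n + 1 : ℝ) ^ (a - 1) *
        ((m + 1 : ℝ) ^ (-s) * (n + 1 : ℝ) ^ (-(B + a - s))) := by gcongr
    _ = _ := by ring

/-- The integrand of the operator on a power `t ^ (σ - 1)`, in the variable `w = 1 - x / t` and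
without the power of `x`. -/
noncomputable def pfaffIntegrand (α α' β β' γ σ : ℂ) (w : ℝ) : ℂ :=
  (w : ℂ) ^ (γ - 1) * (1 - w : ℂ) ^ (α + α' - γ - σ) * pfaffSeries α α' β β' γ w

/-- The quotient of Gamma values by which the operator multiplies the power `t ^ (σ - 1)`. -/
noncomputable def msmPowerFactor (α α' β β' γ σ : ℂ) : ℂ :=
  Complex.Gamma (1 + α + α' - γ - σ) * Complex.Gamma (1 + α + β' - γ - σ) *
    Complex.Gamma (1 - σ - β) * (Complex.Gamma (1 - σ))⁻¹ *
    (Complex.Gamma (1 + α + α' + β' - γ - σ))⁻¹ * (Complex.Gamma (1 + α - β - σ))⁻¹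

/-- The second factor on the left is the integral of `|w ^ (γ + m + n - 1) (1 - w) ^ (A - 1)|` over
`(0, 1)`. -/
theorem exists_norm_pfaffCoeff_mul_beta_le (α α' β β' : ℂ) {γ A : ℂ} (hγ : 0 < γ.re)
    (hA : 0 < A.re) : ∃ C : ℝ, 0 < C ∧ ∀ m n : ℕ,
    ‖pfaffCoeff α α' β β' γ m n‖ * ‖Complex.Gamma ((γ + (m + n : ℕ)).re : ℂ) *
      Complex.Gamma (A.re : ℂ) * (Complex.Gamma ((γ + (m + n : ℕ)).re + A.re))⁻¹‖ ≤
    C * ((m + 1 : ℝ) ^ (α.re + β.re - (γ - β').re - 1) * (n + 1 : ℝ) ^ (α'.re - 1) *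
      (m + n + 1 : ℝ) ^ (-β'.re - A.re)) := by
  obtain ⟨C₁, h1, hC₁⟩ := exists_norm_poch_le α
  obtain ⟨C₂, h2, hC₂⟩ := exists_norm_poch_le β
  obtain ⟨C₃, h3, hC₃⟩ := exists_norm_poch_le α'
  obtain ⟨C₄, h4, hC₄⟩ := exists_norm_poch_shift_le (γ - β')
  obtain ⟨C₅, h5, hC₅⟩ := exists_le_norm_poch (ne_neg_natCast_of_re_pos hγ)
  obtain ⟨C₆, h6, hC₆⟩ := exists_norm_poch_le (γ.re : ℂ)
  obtain ⟨C₇, h7, hC₇⟩ := exists_norm_inv_Gamma_le (γ.re + A.re : ℂ)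
  have hγ' : 0 < (γ.re : ℂ).re := by simpa
  have hG := norm_pos_iff.2 (Complex.Gamma_ne_zero_of_re_pos hγ')
  have hGA := norm_pos_iff.2 (Complex.Gamma_ne_zero_of_re_pos (s := (A.re : ℂ)) (by simpa))
  refine ⟨C₁ * C₂ * C₃ * C₄ * C₅ * C₆ * C₇ * ‖Complex.Gamma (γ.re : ℂ)‖ *
    ‖Complex.Gamma (A.re : ℂ)‖, by positivity, fun m n => ?_⟩
  have e1 : ((γ + (m + n : ℕ)).re : ℂ) = (γ.re : ℂ) + (m + n : ℕ) := by
    simp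
  have e2 : (γ.re : ℂ) + (m + n : ℕ) + A.re = γ.re + A.re + (m + n : ℕ) := by ring
  have b1 := hC₁ m
  have b2 := hC₂ m
  have b3 := hC₃ n
  have b4 := hC₄ m n
  have b5 := hC₅ (m + n)
  have b6 := hC₆ (m + n)
  have b7 := hC₇ (m + n)
  have hp := norm_pos_iff.2 (poch_ne_zero_of_re_pos hγ (m + n))
  have hM : (0 : ℝ) < m + 1 := by positivity
  have hN : (0 : ℝ) < n + 1 := by positivity
  have hS : (0 : ℝ) < m + n + 1 := by positivity
  have b5' : ‖poch γ (m + n)‖⁻¹ ≤ C₅ * ((m + n).factorial * (m + n + 1 : ℝ) ^ (γ.re - 1))⁻¹ := by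
    rw [← div_eq_mul_inv, le_div_iff₀ (by positivity), inv_mul_le_iff₀ hp, mul_comm _ C₅]
    push_cast at b5
    exact b5
  push_cast at b6 b7
  simp only [Complex.add_re, Complex.ofReal_re] at b6 b7
  have hm : (m.factorial : ℝ) ≠ 0 := by positivity
  have hn : (n.factorial : ℝ) ≠ 0 := by positivity
  have hmn : ((m + n).factorial : ℝ) ≠ 0 := by positivity
  rw [e1, e2, Gamma_add_natCast (ne_neg_natCast_of_re_pos hγ'), pfaffCoeff]
  simp only [norm_mul, norm_div, Complex.norm_natCast]
  push_cast
  rw [div_eq_mul_inv, mul_inv, mul_inv]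
  calc _ ≤ (C₁ * (m.factorial * (m + 1 : ℝ) ^ (α.re - 1))) *
        (C₂ * (m.factorial * (m + 1 : ℝ) ^ (β.re - 1))) *
        (C₃ * (n.factorial * (n + 1 : ℝ) ^ (α'.re - 1))) *
        (C₄ * ((m + n).factorial * (m + n + 1 : ℝ) ^ ((γ - β').re - 1) /
          (m.factorial * (m + 1 : ℝ) ^ ((γ - β').re - 1)))) *
        ((C₅ * ((m + n).factorial * (m + n + 1 : ℝ) ^ (γ.re - 1))⁻¹) * (m.factorial : ℝ)⁻¹ *
          (n.factorial : ℝ)⁻¹) *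
        ((C₆ * ((m + n).factorial * (m + n + 1 : ℝ) ^ (γ.re - 1))) * ‖Complex.Gamma (γ.re : ℂ)‖ *
          ‖Complex.Gamma (A.re : ℂ)‖ *
          (C₇ / ((m + n).factorial * (m + n + 1 : ℝ) ^ (γ.re + A.re - 1)))) := by
        gcongr
    _ = _ := by
        rw [show α.re + β.re - (γ - β').re - 1 =
            (α.re - 1) + (β.re - 1) - ((γ - β').re - 1) by ring,
          Real.rpow_sub hM _ ((γ - β').re - 1), Real.rpow_add hM,
          show -β'.re - A.re = ((γ - β').re - 1) - (γ.re + A.re - 1) by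
            rw [Complex.sub_re]; ring, Real.rpow_sub hS _ (γ.re + A.re - 1)]
        field_simp

/-- Gauss's theorem gives the sum over `n` for fixed `m`, and the result is again a Gauss series
in `m`. -/
theorem tsum_pfaffCoeff_mul_beta {α α' β β' γ σ : ℂ} (hγ : 0 < γ.re)
    (hB : 0 < (1 + α + β' - γ - σ).re) (hE : 0 < (1 - σ - β).re)
    (hs : Summable fun k : ℕ × ℕ => pfaffCoeff α α' β β' γ k.1 k.2 *
      (Complex.Gamma (γ + (k.1 + k.2 : ℕ)) * Complex.Gamma (1 + α + α' - γ - σ) *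
        (Complex.Gamma (γ + (k.1 + k.2 : ℕ) + (1 + α + α' - γ - σ)))⁻¹)) :
    ∑' k : ℕ × ℕ, pfaffCoeff α α' β β' γ k.1 k.2 *
      (Complex.Gamma (γ + (k.1 + k.2 : ℕ)) * Complex.Gamma (1 + α + α' - γ - σ) *
        (Complex.Gamma (γ + (k.1 + k.2 : ℕ) + (1 + α + α' - γ - σ)))⁻¹) =
      Complex.Gamma γ * msmPowerFactor α α' β β' γ σ := by
  have hγ' := ne_neg_natCast_of_re_pos hγ
  have h1 : ∀ m : ℕ, ∑' n : ℕ, pfaffCoeff α α' β β' γ m n *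
      (Complex.Gamma (γ + (m + n : ℕ)) * Complex.Gamma (1 + α + α' - γ - σ) *
        (Complex.Gamma (γ + (m + n : ℕ) + (1 + α + α' - γ - σ)))⁻¹) =
      Complex.Gamma γ * Complex.Gamma (1 + α + α' - γ - σ) *
        Complex.Gamma (1 + α + β' - γ - σ) * (Complex.Gamma (1 + α + α' + β' - γ - σ))⁻¹ *
        gaussTerm α β (1 + α - σ) m := by
    intro m
    have hG := tsum_gaussTerm (a := α') (b := γ - β' + m) (c := 1 + α + α' - σ + m)
      (by rwa [show 1 + α + α' - σ + m - α' - (γ - β' + m) = 1 + α + β' - γ - σ by ring])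
    rw [show 1 + α + α' - σ + m - α' - (γ - β' + m) = 1 + α + β' - γ - σ by ring,
      show 1 + α + α' - σ + m - α' = 1 + α - σ + m by ring,
      show 1 + α + α' - σ + m - (γ - β' + m) = 1 + α + α' + β' - γ - σ by ring] at hG
    have e : ∀ n : ℕ, pfaffCoeff α α' β β' γ m n *
        (Complex.Gamma (γ + (m + n : ℕ)) * Complex.Gamma (1 + α + α' - γ - σ) *
          (Complex.Gamma (γ + (m + n : ℕ) + (1 + α + α' - γ - σ)))⁻¹) =
        Complex.Gamma γ * Complex.Gamma (1 + α + α' - γ - σ) *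
          (poch α m * poch β m / (m.factorial : ℂ)) *
          gaussTerm α' (γ - β' + m) (1 + α + α' - σ + m) n := by
      intro n
      have := poch_ne_zero hγ' (m + n)
      rw [Gamma_add_natCast hγ', pfaffCoeff, gaussTerm,
        show γ + (m + n : ℕ) + (1 + α + α' - γ - σ) = 1 + α + α' - σ + m + n by push_cast; ring]
      field_simp
    simp only [e]
    rw [tsum_mul_left, hG, gaussTerm]
    ring
  rw [hs.tsum_prod]
  simp only [h1]
  rw [tsum_mul_left, tsum_gaussTerm (by rwa [show 1 + α - σ - α - β = 1 - σ - β by ring]),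
    show 1 + α - σ - α - β = 1 - σ - β by ring, show 1 + α - σ - α = 1 - σ by ring,
    show 1 + α - σ - β = 1 + α - β - σ by ring, msmPowerFactor]
  ring

/-- When `Re α' > 0` the double series may be integrated term by term. -/
theorem pfaffIntegrand_integral_of_re_pos {α α' β β' γ σ : ℂ} (hα' : 0 < α'.re) (hγ : 0 < γ.re)
    (hA : 0 < (1 + α + α' - γ - σ).re) (hB : 0 < (1 + α + β' - γ - σ).re)
    (hE : 0 < (1 - σ - β).re) :
    IntegrableOn (pfaffIntegrand α α' β β' γ σ) (Ioo 0 1) ∧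
      ∫ w in Ioo (0 : ℝ) 1, pfaffIntegrand α α' β β' γ σ w =
        Complex.Gamma γ * msmPowerFactor α α' β β' γ σ := by
  set A := 1 + α + α' - γ - σ with hAdef
  have hγN : ∀ k : ℕ × ℕ, 0 < (γ + (k.1 + k.2 : ℕ)).re := by
    intro k
    simp only [Complex.add_re, Complex.natCast_re]
    positivity
  let F : ℕ × ℕ → ℝ → ℂ := fun k w => pfaffCoeff α α' β β' γ k.1 k.2 *
    ((w : ℂ) ^ (γ + (k.1 + k.2 : ℕ) - 1) * (1 - w : ℂ) ^ (A - 1))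
  have hF : ∀ k, Integrable (F k) (volume.restrict (Ioo 0 1)) := fun k =>
    (integrableOn_beta (hγN k) hA).const_mul _
  have hFs : Summable fun k => ∫ w in Ioo (0 : ℝ) 1, ‖F k w‖ := by
    obtain ⟨C, h0, hC⟩ := exists_norm_pfaffCoeff_mul_beta_le α α' β β' hγ hA
    refine .of_nonneg_of_le (fun k => integral_nonneg fun _ => norm_nonneg _) (fun k => ?_)
      ((summable_rpow_mul_rpow_mul_rpow_add hB hE hα').mul_left C)
    simp only [F]
    simp only [norm_mul (pfaffCoeff α α' β β' γ k.1 k.2)]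
    rw [integral_const_mul, setIntegral_norm_beta (hγN k) hA]
    refine (hC k.1 k.2).trans_eq ?_
    have e1 : α.re + β.re - (γ - β').re - 1 =
        (1 + α + β' - γ - σ).re - (1 - σ - β).re - 1 := by
      simp only [Complex.add_re, Complex.sub_re, Complex.one_re]; ring
    have e2 : -β'.re - A.re = -(1 + α + β' - γ - σ).re - α'.re := by
      simp only [hAdef, Complex.add_re, Complex.sub_re, Complex.one_re]; ring
    rw [e1, e2]
  have hFe : ∀ w ∈ Ioo (0 : ℝ) 1, ∑' k, F k w = pfaffIntegrand α α' β β' γ σ w := by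
    intro w hw
    have hw0 : (w : ℂ) ≠ 0 := by exact_mod_cast hw.1.ne'
    rw [pfaffIntegrand, pfaffSeries, ← tsum_mul_left]
    congr 1 with k
    simp only [F]
    rw [show γ + (k.1 + k.2 : ℕ) - 1 = γ - 1 + (k.1 + k.2 : ℕ) by ring,
      Complex.cpow_add _ _ hw0, Complex.cpow_natCast, pow_add,
      show A - 1 = α + α' - γ - σ by rw [hAdef]; ring]
    ring
  have hi := integrable_tsum_of_summable_integral_norm hF hFs
  have hsum := hasSum_integral_of_summable_integral_norm hF hFs
  have hFi : ∀ k : ℕ × ℕ, ∫ w in Ioo (0 : ℝ) 1, F k w = pfaffCoeff α α' β β' γ k.1 k.2 *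
      (Complex.Gamma (γ + (k.1 + k.2 : ℕ)) * Complex.Gamma A *
        (Complex.Gamma (γ + (k.1 + k.2 : ℕ) + A))⁻¹) := by
    intro k
    simp only [F]
    rw [integral_const_mul, setIntegral_beta (hγN k) hA]
  simp only [hFi] at hsum
  refine ⟨IntegrableOn.congr_fun hi hFe measurableSet_Ioo, ?_⟩
  rw [← setIntegral_congr_fun measurableSet_Ioo hFe, ← hsum.tsum_eq]
  exact tsum_pfaffCoeff_mul_beta hγ hB hE hsum.summable

theorem msmPowerFactor_contiguous {α α' β β' γ σ : ℂ} (hA : 1 + α + α' - γ - σ ≠ 0) :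
    msmPowerFactor α α' β β' γ σ = msmPowerFactor α (α' + 1) β β' γ σ +
      β' * msmPowerFactor α (α' + 1) β (β' + 1) (γ + 1) σ := by
  simp only [msmPowerFactor]
  rw [show 1 + α + (α' + 1) - γ - σ = 1 + α + α' - γ - σ + 1 by ring,
    show 1 + α + (α' + 1) - (γ + 1) - σ = 1 + α + α' - γ - σ by ring,
    show 1 + α + (β' + 1) - (γ + 1) - σ = 1 + α + β' - γ - σ by ring,
    show 1 + α + (α' + 1) + β' - γ - σ = 1 + α + α' + β' - γ - σ + 1 by ring,
    show 1 + α + (α' + 1) + (β' + 1) - (γ + 1) - σ = 1 + α + α' + β' - γ - σ + 1 by ring,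
    Complex.Gamma_add_one _ hA,
    Complex.one_div_Gamma_eq_self_mul_one_div_Gamma_add_one (1 + α + α' + β' - γ - σ)]
  ring

/-- The general case, by raising `α'`. The two terms of the contiguous relation obey the same
conditions on `σ`. -/
theorem pfaffIntegrand_integral {α α' β β' γ σ : ℂ} (hγ : 0 < γ.re)
    (hA : 0 < (1 + α + α' - γ - σ).re) (hB : 0 < (1 + α + β' - γ - σ).re)
    (hE : 0 < (1 - σ - β).re) :
    IntegrableOn (pfaffIntegrand α α' β β' γ σ) (Ioo 0 1) ∧
      ∫ w in Ioo (0 : ℝ) 1, pfaffIntegrand α α' β β' γ σ w =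
        Complex.Gamma γ * msmPowerFactor α α' β β' γ σ := by
  obtain ⟨N, hN⟩ := exists_nat_gt (-α'.re)
  induction N generalizing α' β' γ with
  | zero => exact pfaffIntegrand_integral_of_re_pos (by simpa using hN) hγ hA hB hE
  | succ N ih =>
    have hN' : -(α' + 1).re < N := by
      push_cast at hN
      simp only [Complex.add_re, Complex.one_re]
      linarith
    have hA0 : 1 + α + α' - γ - σ ≠ 0 := fun h => by simp [h] at hA
    have hγ0 : γ ≠ 0 := fun h => by simp [h] at hγ
    obtain ⟨i1, e1⟩ := ih (α' := α' + 1) (β' := β') (γ := γ) hγ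
      (by rw [show 1 + α + (α' + 1) - γ - σ = 1 + α + α' - γ - σ + 1 by ring, Complex.add_re,
            Complex.one_re]; linarith) hB hN'
    obtain ⟨i2, e2⟩ := ih (α' := α' + 1) (β' := β' + 1) (γ := γ + 1)
      (by rw [Complex.add_re, Complex.one_re]; linarith)
      (by rwa [show 1 + α + (α' + 1) - (γ + 1) - σ = 1 + α + α' - γ - σ by ring])
      (by rwa [show 1 + α + (β' + 1) - (γ + 1) - σ = 1 + α + β' - γ - σ by ring]) hN'
    have key : ∀ w ∈ Ioo (0 : ℝ) 1, pfaffIntegrand α (α' + 1) β β' γ σ w +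
        β' / γ * pfaffIntegrand α (α' + 1) β (β' + 1) (γ + 1) σ w =
        pfaffIntegrand α α' β β' γ σ w := by
      intro w hw
      have hw0 : (w : ℂ) ≠ 0 := by exact_mod_cast hw.1.ne'
      have hw1 : (1 - w : ℂ) ≠ 0 := by exact_mod_cast (sub_pos.2 hw.2).ne'
      have hn : ‖(w : ℂ)‖ < 1 := by
        rw [Complex.norm_real, Real.norm_of_nonneg hw.1.le]; exact hw.2
      rw [pfaffIntegrand, pfaffIntegrand, pfaffIntegrand,
        pfaffSeries_contiguous α α' β β' hγ hn,
        show α + (α' + 1) - γ - σ = α + α' - γ - σ + 1 by ring,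
        show α + (α' + 1) - (γ + 1) - σ = α + α' - γ - σ by ring,
        show γ + 1 - 1 = γ - 1 + 1 by ring, Complex.cpow_add _ _ hw0, Complex.cpow_add _ _ hw1,
        Complex.cpow_one, Complex.cpow_one]
      ring
    refine ⟨IntegrableOn.congr_fun (i1.add (i2.const_mul (β' / γ))) key measurableSet_Ioo, ?_⟩
    rw [← setIntegral_congr_fun measurableSet_Ioo key, integral_add i1 (i2.const_mul (β' / γ)),
      integral_const_mul, e1, e2, msmPowerFactor_contiguous hA0, Complex.Gamma_add_one γ hγ0]
    field_simp

/-! ### The operator on powers -/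

theorem cpow_ofReal_mul {a b : ℝ} (ha : 0 < a) (hb : 0 < b) (s : ℂ) :
    ((a * b : ℝ) : ℂ) ^ s = (a : ℂ) ^ s * (b : ℂ) ^ s := by
  rw [Complex.ofReal_mul, Complex.mul_cpow_ofReal_nonneg ha.le hb.le]

theorem cpow_ofReal_inv {a : ℝ} (ha : 0 < a) (s : ℂ) : ((a⁻¹ : ℝ) : ℂ) ^ s = (a : ℂ) ^ (-s) := by
  have harg : (a : ℂ).arg ≠ Real.pi := by
    rw [Complex.arg_ofReal_of_nonneg ha.le]; exact Real.pi_ne_zero.symm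
  rw [Complex.ofReal_inv, Complex.inv_cpow _ _ harg, Complex.cpow_neg]

theorem image_div_one_sub_Ioo {x : ℝ} (hx : 0 < x) :
    (fun w : ℝ => x / (1 - w)) '' Ioo 0 1 = Ioi x := by
  ext t
  constructor
  · rintro ⟨w, hw, rfl⟩
    have h1 : 0 < 1 - w := by linarith [hw.2]
    rw [mem_Ioi, lt_div_iff₀ h1]
    nlinarith [hw.1]
  · intro ht
    have ht' : x < t := ht
    have ht0 : 0 < t := hx.trans ht'
    refine ⟨1 - x / t, ⟨?_, ?_⟩, ?_⟩
    · rw [sub_pos, div_lt_one ht0]; exact ht'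
    · have : 0 < x / t := by positivity
      linarith
    · have := hx.ne'
      simp only [sub_sub_cancel]
      field_simp

theorem msmRightIntegrand_power_div_one_sub (α α' β β' σ : ℂ) {γ : ℂ} (hγ : 0 < γ.re) {x w : ℝ}
    (hx : 0 < x) (hw : w ∈ Ioo (0 : ℝ) 1) :
    |x / (1 - w) ^ 2| • msmRightIntegrand α α' β β' γ (fun t : ℝ => (t : ℂ) ^ (σ - 1)) x
      (x / (1 - w)) = (x : ℂ) ^ (σ - α + γ - 1) * pfaffIntegrand α α' β β' γ σ w := by
  have hq : 0 < 1 - w := by linarith [hw.2]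
  have hqc : ((1 - w : ℝ) : ℂ) ≠ 0 := by exact_mod_cast hq.ne'
  have hxc : (x : ℂ) ≠ 0 := by exact_mod_cast hx.ne'
  have e1 : x / (1 - w) - x = x * (w * (1 - w)⁻¹) := by field_simp; ring
  have e2 : (1 - (x : ℂ) / ((x / (1 - w) : ℝ) : ℂ)) = w := by
    push_cast at hqc ⊢
    field_simp
    ring
  have e3 : (1 - ((x / (1 - w) : ℝ) : ℂ) / (x : ℂ)) = 1 - 1 / (1 - w) := by
    push_cast at hqc ⊢
    field_simp
  have e4 : (1 - w : ℂ) = ((1 - w : ℝ) : ℂ) := by push_cast; rfl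
  rw [abs_of_pos (by positivity), msmRightIntegrand, e1, e2, e3,
    appellF3_eq_pfaffSeries α α' β β' (ne_neg_natCast_of_re_pos hγ) hw, pfaffIntegrand, e4,
    div_eq_mul_inv x (1 - w)]
  simp only [cpow_ofReal_mul hx (mul_pos hw.1 (inv_pos.2 hq)),
    cpow_ofReal_mul hw.1 (inv_pos.2 hq), cpow_ofReal_mul hx (inv_pos.2 hq), cpow_ofReal_inv hq]
  have e5 : (x : ℂ) ^ (σ - α + γ - 1) =
      x * ((x : ℂ) ^ (γ - 1) * (x : ℂ) ^ (-α) * (x : ℂ) ^ (σ - 1)) := by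
    rw [← Complex.cpow_add _ _ hxc, ← Complex.cpow_add _ _ hxc,
      show σ - α + γ - 1 = 1 + (γ - 1 + -α + (σ - 1)) by ring, Complex.cpow_add _ _ hxc,
      Complex.cpow_one]
  have e6 : ((1 - w : ℝ) : ℂ) ^ (α + α' - γ - σ) =
      (((1 - w : ℝ) : ℂ) ^ (-(γ - 1)) * ((1 - w : ℝ) : ℂ) ^ (- -α) *
        ((1 - w : ℝ) : ℂ) ^ (-(σ - 1)) * ((1 - w : ℝ) : ℂ) ^ α') / ((1 - w : ℝ) : ℂ) ^ 2 := by
    rw [← Complex.cpow_add _ _ hqc, ← Complex.cpow_add _ _ hqc, ← Complex.cpow_add _ _ hqc,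
      ← Complex.cpow_ofNat, ← Complex.cpow_sub _ _ hqc]
    congr 1; ring
  rw [e5, e6, Complex.real_smul, Complex.ofReal_div, Complex.ofReal_pow]
  ring

/-- The image of a power under the operator, up to the factor in front of its integral. -/
theorem msmRightIntegrand_power {α α' β β' γ σ : ℂ} (hγ : 0 < γ.re)
    (hA : 0 < (1 + α + α' - γ - σ).re) (hB : 0 < (1 + α + β' - γ - σ).re)
    (hE : 0 < (1 - σ - β).re) {x : ℝ} (hx : 0 < x) :
    IntegrableOn (msmRightIntegrand α α' β β' γ (fun t : ℝ => (t : ℂ) ^ (σ - 1)) x) (Ioi x) ∧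
      ∫ t in Ioi x, msmRightIntegrand α α' β β' γ (fun t : ℝ => (t : ℂ) ^ (σ - 1)) x t =
        (x : ℂ) ^ (σ - α + γ - 1) * (Complex.Gamma γ * msmPowerFactor α α' β β' γ σ) := by
  obtain ⟨hi, he⟩ := pfaffIntegrand_integral hγ hA hB hE
  have hd : ∀ w ∈ Ioo (0 : ℝ) 1,
      HasDerivWithinAt (fun w : ℝ => x / (1 - w)) (x / (1 - w) ^ 2) (Ioo 0 1) w := by
    intro w hw
    have hq : 1 - w ≠ 0 := by linarith [hw.2]
    have h := (hasDerivAt_const w x).fun_div ((hasDerivAt_id w).const_sub 1) hq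
    refine HasDerivAt.hasDerivWithinAt (h.congr_deriv ?_)
    simp
  have hinj : InjOn (fun w : ℝ => x / (1 - w)) (Ioo 0 1) := by
    intro a ha b hb hab
    have h1 : 1 - a ≠ 0 := by linarith [ha.2]
    have h2 : 1 - b ≠ 0 := by linarith [hb.2]
    simp only at hab
    field_simp at hab
    linarith
  have hcongr : EqOn (fun w : ℝ => |x / (1 - w) ^ 2| •
      msmRightIntegrand α α' β β' γ (fun t : ℝ => (t : ℂ) ^ (σ - 1)) x (x / (1 - w)))
      (fun w => (x : ℂ) ^ (σ - α + γ - 1) * pfaffIntegrand α α' β β' γ σ w) (Ioo 0 1) :=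
    fun w hw => msmRightIntegrand_power_div_one_sub α α' β β' σ hγ hx hw
  rw [← image_div_one_sub_Ioo hx]
  constructor
  · rw [integrableOn_image_iff_integrableOn_abs_deriv_smul measurableSet_Ioo hd hinj]
    exact IntegrableOn.congr_fun (hi.const_mul _) hcongr.symm measurableSet_Ioo
  · rw [integral_image_eq_integral_abs_deriv_smul measurableSet_Ioo hd hinj,
      setIntegral_congr_fun measurableSet_Ioo hcongr, integral_const_mul, he]

/-! ### The generalized Bessel function -/

theorem summable_pow_div_Gamma_mul_factorial (κ : ℂ) (r : ℝ) (hr : 0 ≤ r) :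
    Summable fun k : ℕ => r ^ k * (‖(Complex.Gamma (κ + k))⁻¹‖ / k.factorial) := by
  obtain ⟨C, h0, hC⟩ := exists_norm_inv_Gamma_le κ
  obtain ⟨K, hK⟩ := exists_nat_ge (-(κ.re - 1))
  have hs := (Real.summable_pow_div_factorial (r * Real.exp 1)).mul_left
    (C * K.factorial * Real.exp 1)
  refine .of_nonneg_of_le (fun k => by positivity) (fun k => ?_) hs
  have hk : (0 : ℝ) < k + 1 := by positivity
  have h1 : (1 : ℝ) ≤ k.factorial := by exact_mod_cast Nat.succ_le_of_lt k.factorial_pos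
  have h2 : (k + 1 : ℝ) ^ (-(κ.re - 1)) ≤ K.factorial * (Real.exp 1 * Real.exp 1 ^ k) := by
    calc _ ≤ (k + 1 : ℝ) ^ (K : ℝ) := by gcongr; linarith [k.cast_nonneg (α := ℝ)]
      _ = (k + 1 : ℝ) ^ K := Real.rpow_natCast _ _
      _ ≤ K.factorial * Real.exp (k + 1) := by
        rw [mul_comm, ← div_le_iff₀ (by positivity)]
        exact Real.pow_div_factorial_le_exp _ hk.le K
      _ = _ := by rw [add_comm, Real.exp_add, ← Real.exp_nat_mul, mul_one]
  have h3 : ‖(Complex.Gamma (κ + k))⁻¹‖ ≤ C * (K.factorial * (Real.exp 1 * Real.exp 1 ^ k)) := by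
    refine (hC k).trans ?_
    rw [div_eq_mul_inv]
    gcongr
    rw [mul_inv, ← Real.rpow_neg hk.le]
    calc _ ≤ 1 * (k + 1 : ℝ) ^ (-(κ.re - 1)) := by gcongr; exact inv_le_one_of_one_le₀ h1
      _ ≤ _ := by rwa [one_mul]
  calc _ ≤ r ^ k * (C * (K.factorial * (Real.exp 1 * Real.exp 1 ^ k)) / k.factorial) := by gcongr
    _ = _ := by rw [mul_pow]; ring

/-- The coefficient of `t ^ (-(2 k + p))` in the expansion of `𝓦_{p,b,c}(1 / t)`. -/
noncomputable def besselWCoeff (p b c : ℂ) (k : ℕ) : ℂ :=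
  (-1) ^ k * c ^ k / (Complex.Gamma (p + (b + 1) / 2 + (k : ℂ)) * (k.factorial : ℂ)) *
    (2 : ℂ) ^ (-(2 * (k : ℂ) + p))

theorem besselW_term_one_div (p b c : ℂ) (k : ℕ) {t : ℝ} (ht : 0 < t) :
    (-1) ^ k * c ^ k / (Complex.Gamma (p + (b + 1) / 2 + (k : ℂ)) * (k.factorial : ℂ)) *
      (1 / (t : ℂ) / 2) ^ (2 * (k : ℂ) + p) =
      besselWCoeff p b c k * (t : ℂ) ^ (-(2 * (k : ℂ) + p)) := by
  have e : (1 / (t : ℂ) / 2) = (((2 * t)⁻¹ : ℝ) : ℂ) := by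
    push_cast
    rw [mul_inv, mul_comm]; ring
  rw [e, cpow_ofReal_inv (by positivity), cpow_ofReal_mul two_pos ht, besselWCoeff]
  push_cast
  ring

theorem cpow_sub_two_mul {t : ℂ} (ht : t ≠ 0) (s : ℂ) (k : ℕ) :
    t ^ (s - 2 * (k : ℂ)) = t ^ s * ((t ^ 2) ^ k)⁻¹ := by
  rw [Complex.cpow_sub _ _ ht, ← pow_mul, div_eq_mul_inv, ← Complex.cpow_natCast t (2 * k)]
  push_cast
  rfl

theorem summable_norm_besselWCoeff (p b c : ℂ) {x : ℝ} (hx : 0 < x) :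
    Summable fun k : ℕ => ‖besselWCoeff p b c k‖ * ((x ^ 2) ^ k)⁻¹ := by
  have h := (summable_pow_div_Gamma_mul_factorial (p + (b + 1) / 2) (‖c‖ / 4 * (x ^ 2)⁻¹)
    (by positivity)).mul_left ‖(2 : ℂ) ^ (-p)‖
  refine h.congr fun k => ?_
  rw [besselWCoeff, show -(2 * (k : ℂ) + p) = -p - 2 * (k : ℂ) by ring,
    cpow_sub_two_mul two_ne_zero]
  simp only [norm_mul, norm_div, norm_pow, norm_inv, norm_neg, norm_one, one_pow, one_mul,
    Complex.norm_natCast, Complex.norm_ofNat, mul_pow, div_pow, inv_pow]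
  rw [show ((2 : ℝ) ^ 2) = 4 by norm_num]
  ring

theorem wrightTerm_eq_besselWCoeff_mul (α α' β β' γ ρ p b c : ℂ) {x : ℝ} (hx : 0 < x)
    (hγ : Complex.Gamma γ ≠ 0) (k : ℕ) :
    (x : ℂ) ^ (-α') / Complex.Gamma γ * (besselWCoeff p b c k *
      ((x : ℂ) ^ (ρ - p - 2 * (k : ℂ) - α + γ - 1) *
        (Complex.Gamma γ * msmPowerFactor α α' β β' γ (ρ - p - 2 * (k : ℂ))))) =
    (x : ℂ) ^ (ρ - p - α - α' + γ - 1) / (2 : ℂ) ^ p * wrightTerm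
      ![1 - ρ + p - γ + α + α', 1 - ρ + p + α + β' - γ, 1 - ρ + p - β] ![2, 2, 2]
      ![1 - ρ + p, 1 - ρ + p - γ + α + α' + β', 1 - ρ + p + α - β, p + (b + 1) / 2] ![2, 2, 2, 1]
      (-c / (4 * (x : ℂ) ^ 2)) k := by
  have hxc : (x : ℂ) ≠ 0 := by exact_mod_cast hx.ne'
  have e1 : (x : ℂ) ^ (ρ - p - 2 * (k : ℂ) - α + γ - 1) =
      (x : ℂ) ^ (ρ - p - α + γ - 1) * (((x : ℂ) ^ 2) ^ k)⁻¹ := by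
    rw [← cpow_sub_two_mul hxc]; congr 1; ring
  have e2 : (x : ℂ) ^ (ρ - p - α - α' + γ - 1) =
      (x : ℂ) ^ (-α') * (x : ℂ) ^ (ρ - p - α + γ - 1) := by
    rw [← Complex.cpow_add _ _ hxc]; congr 1; ring
  have e3 : (2 : ℂ) ^ (-(2 * (k : ℂ) + p)) = ((2 : ℂ) ^ p)⁻¹ * ((4 : ℂ) ^ k)⁻¹ := by
    rw [show -(2 * (k : ℂ) + p) = -p - 2 * (k : ℂ) by ring, cpow_sub_two_mul two_ne_zero,
      Complex.cpow_neg]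
    norm_num
  have e4 : (-c / (4 * (x : ℂ) ^ 2)) ^ k =
      (-1) ^ k * c ^ k * ((4 : ℂ) ^ k)⁻¹ * (((x : ℂ) ^ 2) ^ k)⁻¹ := by
    rw [div_pow, neg_pow, mul_pow, div_eq_mul_inv, mul_inv]; ring
  have e0 : ∀ a d s M : ℂ, a / Complex.Gamma γ * (d * (s * (Complex.Gamma γ * M))) =
      a * (d * (s * M)) := fun a d s M => by field_simp
  rw [e0, e1, e2, besselWCoeff, e3, wrightTerm, e4, Fin.prod_univ_three, Fin.prod_univ_four,
    msmPowerFactor]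
  simp only [Matrix.cons_val, Complex.ofReal_ofNat, Complex.ofReal_one, one_mul]
  rw [show 1 - ρ + p - γ + α + α' + 2 * (k : ℂ) = 1 + α + α' - γ - (ρ - p - 2 * (k : ℂ)) by ring,
    show 1 - ρ + p + α + β' - γ + 2 * (k : ℂ) = 1 + α + β' - γ - (ρ - p - 2 * (k : ℂ)) by ring,
    show 1 - ρ + p - β + 2 * (k : ℂ) = 1 - (ρ - p - 2 * (k : ℂ)) - β by ring,
    show 1 - ρ + p + 2 * (k : ℂ) = 1 - (ρ - p - 2 * (k : ℂ)) by ring,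
    show 1 - ρ + p - γ + α + α' + β' + 2 * (k : ℂ) =
      1 + α + α' + β' - γ - (ρ - p - 2 * (k : ℂ)) by ring,
    show 1 - ρ + p + α - β + 2 * (k : ℂ) = 1 + α - β - (ρ - p - 2 * (k : ℂ)) by ring]
  simp only [div_eq_mul_inv, mul_inv]
  ring

/-! ### The Bessel expansion under the integral sign -/

theorem theorem2 (α α' β β' γ ρ p b c : ℂ) (x : ℝ) (hx : 0 < x)
    (hκ : ∀ n : ℕ, p + (b + 1) / 2 ≠ -(n : ℂ))
    (hγ : 0 < γ.re)
    (hρ : (ρ - p).re <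
      1 + min (-β).re (min (α + α' - γ).re (α + β' - γ).re)) :
    IntegrableOn
      (msmRightIntegrand α α' β β' γ
        (fun t : ℝ => (t : ℂ) ^ (ρ - 1) * besselW p b c (1 / (t : ℂ))) x) (Ioi x) ∧
    Summable (wrightTerm
      ![1 - ρ + p - γ + α + α', 1 - ρ + p + α + β' - γ, 1 - ρ + p - β] ![2, 2, 2]
      ![1 - ρ + p, 1 - ρ + p - γ + α + α' + β', 1 - ρ + p + α - β, p + (b + 1) / 2] ![2, 2, 2, 1]
      (-c / (4 * (x : ℂ) ^ 2))) ∧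
    msmRight α α' β β' γ
        (fun t : ℝ => (t : ℂ) ^ (ρ - 1) * besselW p b c (1 / (t : ℂ))) x =
      (x : ℂ) ^ (ρ - p - α - α' + γ - 1) / (2 : ℂ) ^ p *
        wrightPsi
          ![1 - ρ + p - γ + α + α', 1 - ρ + p + α + β' - γ, 1 - ρ + p - β] ![2, 2, 2]
          ![1 - ρ + p, 1 - ρ + p - γ + α + α' + β', 1 - ρ + p + α - β, p + (b + 1) / 2]
          ![2, 2, 2, 1]
          (-c / (4 * (x : ℂ) ^ 2)) := by
  have hxc : (x : ℂ) ≠ 0 := by exact_mod_cast hx.ne'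
  have hG := Complex.Gamma_ne_zero_of_re_pos hγ
  simp only [Complex.sub_re, Complex.add_re, Complex.neg_re, ← sub_lt_iff_lt_add', lt_min_iff] at hρ
  obtain ⟨r1, r2, r3⟩ := hρ
  -- The operator may be applied to every power in the expansion of the Bessel function.
  have hpow := fun k : ℕ => msmRightIntegrand_power (α := α) (α' := α') (β := β) (β' := β')
    (γ := γ) (σ := ρ - p - 2 * (k : ℂ)) hγ
    (by simp; linarith [k.cast_nonneg (α := ℝ)]) (by simp; linarith [k.cast_nonneg (α := ℝ)])
    (by simp; linarith [k.cast_nonneg (α := ℝ)]) hx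
  let F : ℕ → ℝ → ℂ := fun k t => besselWCoeff p b c k *
    msmRightIntegrand α α' β β' γ (fun t : ℝ => (t : ℂ) ^ (ρ - p - 2 * (k : ℂ) - 1)) x t
  have hF : ∀ k, Integrable (F k) (volume.restrict (Ioi x)) := fun k => (hpow k).1.const_mul _
  have hFn : ∀ k, ∫ t in Ioi x, ‖F k t‖ ≤ ‖besselWCoeff p b c k‖ * ((x ^ 2) ^ k)⁻¹ *
      ∫ t in Ioi x, ‖msmRightIntegrand α α' β β' γ
        (fun t : ℝ => (t : ℂ) ^ (ρ - p - 2 * ((0 : ℕ) : ℂ) - 1)) x t‖ := by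
    intro k
    rw [← integral_const_mul]
    refine setIntegral_mono_on (hF k).norm ((hpow 0).1.norm.const_mul _) measurableSet_Ioi
      fun t ht => ?_
    have ht' : x < t := ht
    have ht0 : 0 < t := hx.trans ht'
    have htc : (t : ℂ) ≠ 0 := by exact_mod_cast ht0.ne'
    have e : ρ - p - 2 * (k : ℂ) - 1 = ρ - p - 2 * ((0 : ℕ) : ℂ) - 1 - 2 * (k : ℂ) := by
      push_cast; ring
    simp only [F, msmRightIntegrand]
    rw [e, cpow_sub_two_mul htc]
    simp only [norm_mul, norm_inv, norm_pow, Complex.norm_real, Real.norm_of_nonneg ht0.le]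
    have hle : ((t ^ 2) ^ k)⁻¹ ≤ ((x ^ 2) ^ k)⁻¹ := by gcongr
    rw [mul_assoc ‖besselWCoeff p b c k‖, ← mul_assoc _ _ ((t ^ 2) ^ k)⁻¹,
      mul_comm _ ((t ^ 2) ^ k)⁻¹]
    gcongr
  have hFs : Summable fun k => ∫ t in Ioi x, ‖F k t‖ :=
    .of_nonneg_of_le (fun k => integral_nonneg fun _ => norm_nonneg _) hFn
      ((summable_norm_besselWCoeff p b c hx).mul_right _)
  have hFe : EqOn (fun t => ∑' k, F k t) (msmRightIntegrand α α' β β' γ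
      (fun t : ℝ => (t : ℂ) ^ (ρ - 1) * besselW p b c (1 / (t : ℂ))) x) (Ioi x) := by
    intro t ht
    have ht0 : 0 < t := hx.trans ht
    have htc : (t : ℂ) ≠ 0 := by exact_mod_cast ht0.ne'
    simp only [msmRightIntegrand, besselW]
    rw [← tsum_mul_left, ← tsum_mul_left]
    congr 1 with k
    rw [besselW_term_one_div p b c k ht0]
    simp only [F, msmRightIntegrand]
    rw [show ρ - p - 2 * (k : ℂ) - 1 = ρ - 1 + -(2 * (k : ℂ) + p) by ring,
      Complex.cpow_add _ _ htc]
    ring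
  have hint := integrable_tsum_of_summable_integral_norm hF hFs
  have hsum := (hasSum_integral_of_summable_integral_norm hF hFs).mul_left
    ((x : ℂ) ^ (-α') / Complex.Gamma γ)
  have hFi : ∀ k, ∫ t in Ioi x, F k t = besselWCoeff p b c k *
      ((x : ℂ) ^ (ρ - p - 2 * (k : ℂ) - α + γ - 1) *
        (Complex.Gamma γ * msmPowerFactor α α' β β' γ (ρ - p - 2 * (k : ℂ)))) := by
    intro k
    simp only [F]
    rw [integral_const_mul, (hpow k).2]
  simp only [hFi, wrightTerm_eq_besselWCoeff_mul α α' β β' γ ρ p b c hx hG] at hsum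
  rw [setIntegral_congr_fun measurableSet_Ioi hFe] at hsum
  have hne : (x : ℂ) ^ (ρ - p - α - α' + γ - 1) / (2 : ℂ) ^ p ≠ 0 :=
    div_ne_zero (by simp [Complex.cpow_eq_zero_iff, hxc]) (by simp [Complex.cpow_eq_zero_iff])
  refine ⟨IntegrableOn.congr_fun hint hFe measurableSet_Ioi,
    (summable_mul_left_iff hne).1 hsum.summable, ?_⟩
  rw [msmRight, wrightPsi, ← tsum_mul_left]
  exact hsum.tsum_eq.symm
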